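/- **Notation.** Let $1\le p\le\infty$. $G$ is the set of functions on $\mathbb R$ of the form $$a(t)=\sum_{j}a_j e^{i\delta_j t}+\int_{-\infty}^{\infty}k(s)e^{its}\,ds,\qquad \sum_j|a_j|<\infty,\quad k\in L^1(\mathbb R),$$ with pairwise distinct $\delta_j\in\mathbb R$; $G^+$ (resp. $G^-$) consists of those $a\in G$ with all $\delta_j\ge 0$ and $k=0$ on $(-\infty,0)$ (resp. all $\delta_j\le 0$ and $k=0$ on $(0,\infty)$). For $a\in G$ let $(W^0(a)f)(t)=\sum_j a_jf(t-\delta_j)+\int_{-\infty}^\infty k(t-s)f(s)\,ds$ on $L^p(\mathbb R)$. Let $Pf=\chi_{(0,\infty)}f$, $Q=I-P$, $(Jf)(t)=f(-t)$, let $L^p(\mathbb R^+)$ be the subspace of functions in $L^p(\mathbb R)$ vanishing on $(-\infty,0)$, and let $W(a)=PW^0(a)$ on $L^p(\mathbb R^+)$. Write $\widetilde a(t)=a(-t)$. A function $g\in G$ is a matching function if $g\widetilde g=1$; for such $g$ put $$\mathbf P(g)=JQW^0(g)P|_{\ker W(g)},\qquad \mathbf P^{\pm}(g)=\tfrac12\,(I\pm\mathbf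 P(g))\quad\text{on }\ker W(g).$$ For $j\ge 0$ let $\psi_j(t)=\sqrt2\,e^{-t}\Lambda_j(2t)$ for $t>0$ and $\psi_j(t)=0$ for $t<0$, where $\Lambda_j(x)=\sum_{i=0}^{j}\binom ji\frac{(-1)^i}{i!}x^i$ is the normalized Laguerre polynomial. **Theorem.** Let $g\in G$ be a matching function such that $W(g):L^p(\mathbb R^+)\to L^p(\mathbb R^+)$ is Fredholm with index $n:=\dim\ker W(g)-\dim\operatorname{coker}W(g)>0$, and let $$g(t)=g_-(t)\Big(\frac{t-i}{t+i}\Big)^{-n}g_+(t),\qquad g_-(0)=1,$$ be its Wiener–Hopf factorization, where $g_-$ and $g_+$ have no zeros on $\mathbb R$, $g_-^{\pm1}\in G^-$ and $g_+^{\pm1}\in G^+$. Put $\boldsymbol\sigma(g)=(-1)^ng(0)$. Then $\boldsymbol\sigma(g)\in\{1,-1\}$, $g_-=\boldsymbol\sigma(g)\,\widetilde g_+^{-1}$, that is, $$g(t)=\boldsymbol\sigma(g)\,\widetilde g_+^{-1}(t)\Big(\frac{t-i}{t+i}\Big)^{-n}g_+(t),$$ and, for each choice of the sign $\pm$, the following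 holds. 1. If $n=2m$, $m\in\mathbb N$, then the functions $W(g_+^{-1})(\psi_{m-k-1}\mp\boldsymbol\sigma(g)\psi_{m+k})$, $k=0,1,\dots,m-1$, form a basis of $\operatorname{im}\mathbf P^{\pm}(g)$, and $\dim\operatorname{im}\mathbf P^{\pm}(g)=m$. 2. If $n=2m+1$, $m\in\mathbb Z_+$, then among the functions $W(g_+^{-1})(\psi_{m+k}\mp\boldsymbol\sigma(g)\psi_{m-k})$, $k=0,1,\dots,m$, the one with index $k$ is zero if and only if $k=0$ and $\pm\boldsymbol\sigma(g)=1$; the non-zero ones form a basis of $\operatorname{im}\mathbf P^{\pm}(g)$, and $\dim\operatorname{im}\mathbf P^{\pm}(g)=m+\frac{1\mp\boldsymbol\sigma(g)}{2}$. -/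

import Mathlib

open MeasureTheory Complex
open scoped ENNReal

namespace WienerHopf

/-! ### The algebras `G`, `G⁺`, `G⁻` -/

/-- The data `(a_δ)_{δ ∈ ℝ}` and `k` in the representation
`a(t) = ∑_δ a_δ e^{iδt} + ∫ k(s) e^{its} ds` with `∑ |a_δ| < ∞` and `∫ |k(s)| ds < ∞`.
An absolutely summable family on `ℝ` has countable support, so indexing by all `δ ∈ ℝ` is the same
as choosing a sequence of pairwise distinct frequencies. -/
structure Rep where
  coeff : ℝ → ℂ
  summable_coeff : Summable fun δ => ‖coeff δ‖
  kernel : ℝ → ℂ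
  integrable_kernel : Integrable kernel volume

/-- The function on the real line given by the data. -/
noncomputable def Rep.symbol (r : Rep) (t : ℝ) : ℂ :=
  ∑' δ : ℝ, r.coeff δ * cexp (I * δ * t) + ∫ s : ℝ, r.kernel s * cexp (I * t * s)

/-- The algebra `G`. -/
def G : Set (ℝ → ℂ) := Set.range Rep.symbol

/-- The algebra `G⁺`: frequencies in `[0, ∞)`, kernel vanishing on the negative semi-axis. -/
def GPlus : Set (ℝ → ℂ) :=
  Rep.symbol '' {r | (∀ δ < 0, r.coeff δ = 0) ∧ ∀ᵐ s : ℝ, s < 0 → r.kernel s = 0}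

/-- The algebra `G⁻`: frequencies in `(-∞, 0]`, kernel vanishing on the positive semi-axis. -/
def GMinus : Set (ℝ → ℂ) :=
  Rep.symbol '' {r | (∀ δ > 0, r.coeff δ = 0) ∧ ∀ᵐ s : ℝ, 0 < s → r.kernel s = 0}

/-! ### Uniqueness of the representation -/

/-- The finite measure `∑_δ u(δ)⁺ δ_δ + h⁺ ds`. -/
noncomputable def posMeasure (u h : ℝ → ℝ) : Measure ℝ :=
  Measure.sum (fun δ : ℝ => ENNReal.ofReal (u δ) • Measure.dirac δ) +
    volume.withDensity (fun s => ENNReal.ofReal (h s))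

lemma isFiniteMeasure_posMeasure {u h : ℝ → ℝ} (hu : Summable fun δ => |u δ|)
    (hh : Integrable h volume) : IsFiniteMeasure (posMeasure u h) := by
  have h1 : IsFiniteMeasure (Measure.sum (fun δ : ℝ => ENNReal.ofReal (u δ) • Measure.dirac δ)) := by
    refine ⟨?_⟩
    rw [Measure.sum_apply _ MeasurableSet.univ]
    simp only [Measure.smul_apply, measure_univ, smul_eq_mul, mul_one]
    refine lt_of_le_of_lt (ENNReal.tsum_le_tsum fun δ => ENNReal.ofReal_le_ofReal (le_abs_self _)) ?_
    exact hu.tsum_ofReal_lt_top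
  have h2 : IsFiniteMeasure (volume.withDensity (fun s => ENNReal.ofReal (h s))) :=
    isFiniteMeasure_withDensity_ofReal hh.2
  unfold posMeasure
  infer_instance

lemma charFun_posMeasure {u h : ℝ → ℝ} (hu : Summable fun δ => |u δ|)
    (hh : Integrable h volume) (t : ℝ) :
    charFun (posMeasure u h) t = ∑' δ : ℝ, ((max (u δ) 0 : ℝ) : ℂ) * cexp (t * δ * I) +
      ∫ s : ℝ, ((max (h s) 0 : ℝ) : ℂ) * cexp (t * s * I) := by
  have hfin := isFiniteMeasure_posMeasure hu hh
  have hint : Integrable (fun x : ℝ => cexp (t * x * I)) (posMeasure u h) := by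
    refine (integrable_const (1 : ℝ)).mono' (by fun_prop) ?_
    refine Filter.Eventually.of_forall fun x => ?_
    rw [← ofReal_mul, norm_exp_ofReal_mul_I]
  rw [charFun_apply_real]
  unfold posMeasure at hint ⊢
  rw [integrable_add_measure] at hint
  rw [integral_add_measure hint.1 hint.2, integral_sum_measure hint.1]
  congr 1
  · refine tsum_congr fun δ => ?_
    rw [integral_smul_measure, integral_dirac, ENNReal.toReal_ofReal']
    simp
  · rw [integral_withDensity_eq_integral_toReal_smul₀ (by exact hh.1.aemeasurable.ennreal_ofReal)
      (by simp)]
    refine integral_congr_ae (Filter.Eventually.of_forall fun s => ?_)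
    simp [ENNReal.toReal_ofReal']

lemma posMeasure_singleton (u h : ℝ → ℝ) (x : ℝ) :
    posMeasure u h {x} = ENNReal.ofReal (u x) := by
  unfold posMeasure
  rw [Measure.add_apply, Measure.sum_apply _ (measurableSet_singleton x)]
  rw [withDensity_absolutelyContinuous volume _ (by simp : volume {x} = 0), add_zero,
    tsum_eq_single x]
  · simp
  · intro y hy
    simp [hy]

lemma real_unique {u h : ℝ → ℝ} (hu : Summable fun δ => |u δ|) (hh : Integrable h volume)
    (H : ∀ t : ℝ, ∑' δ : ℝ, (u δ : ℂ) * cexp (t * δ * I) +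
      ∫ s : ℝ, (h s : ℂ) * cexp (t * s * I) = 0) :
    (∀ δ, u δ = 0) ∧ h =ᵐ[volume] 0 := by
  have hu' : Summable fun δ => |-u δ| := by simpa using hu
  have f1 := isFiniteMeasure_posMeasure hu hh
  have f2 := isFiniteMeasure_posMeasure hu' hh.neg
  have heq : posMeasure u h = posMeasure (fun δ => -u δ) (-h) := by
    refine Measure.ext_of_charFun (funext fun t => ?_)
    rw [charFun_posMeasure hu hh, charFun_posMeasure hu' hh.neg, ← sub_eq_zero, ← H t]
    have hn : ∀ x : ℝ, ‖cexp (t * x * I)‖ = 1 := fun x => by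
      rw [← ofReal_mul, norm_exp_ofReal_mul_I]
    have s1 : ∀ v : ℝ → ℝ, (∀ δ, |v δ| ≤ |u δ|) →
        Summable fun δ : ℝ => (v δ : ℂ) * cexp (t * δ * I) := fun v hv => by
      refine Summable.of_norm_bounded hu fun δ => ?_
      rw [norm_mul, hn, mul_one, norm_real]
      exact hv δ
    have i1 : ∀ v : ℝ → ℝ, Integrable v volume →
        Integrable (fun s : ℝ => (v s : ℂ) * cexp (t * s * I)) volume := fun v hv => by
      refine Integrable.mul_bdd (c := 1) hv.ofReal (by fun_prop) ?_
      exact Filter.Eventually.of_forall fun s => (hn s).le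
    have e1 := (s1 (fun δ => max (u δ) 0) (fun δ => by
      rcases le_total (u δ) 0 with h | h <;> simp [h])).tsum_sub
      (s1 (fun δ => max (-u δ) 0) (fun δ => by
      rcases le_total (u δ) 0 with h | h <;> simp [h]))
    have e2 := integral_sub (i1 _ hh.pos_part) (i1 _ hh.neg.pos_part)
    have k : ∀ x : ℝ, max x 0 - max (-x) 0 = x := fun x => by
      rcases le_total x 0 with h | h <;> simp [h]
    rw [add_sub_add_comm, ← e1, ← e2]
    congr 1
    · refine tsum_congr fun δ => ?_
      rw [← sub_mul, ← ofReal_sub, k]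
    · refine integral_congr_ae (Filter.Eventually.of_forall fun s => ?_)
      simp only [Pi.neg_apply]
      rw [← sub_mul, ← ofReal_sub, k]
  have hzero : ∀ δ, u δ = 0 := fun δ => by
    have := congrArg (fun μ => μ {δ}) heq
    simp only [posMeasure_singleton] at this
    rcases le_total (u δ) 0 with h | h
    · rw [ENNReal.ofReal_of_nonpos h] at this
      have := ENNReal.ofReal_eq_zero.1 this.symm
      linarith
    · rw [ENNReal.ofReal_of_nonpos (neg_nonpos.2 h)] at this
      have := ENNReal.ofReal_eq_zero.1 this
      linarith
  refine ⟨hzero, ?_⟩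
  have hd : volume.withDensity (fun s => ENNReal.ofReal (h s)) =
      volume.withDensity (fun s => ENNReal.ofReal ((-h) s)) := by
    simpa [posMeasure, hzero] using heq
  have := (withDensity_eq_iff (by exact hh.1.aemeasurable.ennreal_ofReal)
    (by exact hh.neg.1.aemeasurable.ennreal_ofReal) hh.lintegral_lt_top.ne).1 hd
  filter_upwards [this] with s hs
  simp only [Pi.neg_apply] at hs
  rcases le_total (h s) 0 with h | h
  · rw [ENNReal.ofReal_of_nonpos h] at hs
    have := ENNReal.ofReal_eq_zero.1 hs.symm
    simp only [Pi.zero_apply]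
    linarith
  · rw [ENNReal.ofReal_of_nonpos (neg_nonpos.2 h)] at hs
    have := ENNReal.ofReal_eq_zero.1 hs
    simp only [Pi.zero_apply]
    linarith

lemma complex_unique {c k : ℝ → ℂ} (hc : Summable fun δ => ‖c δ‖) (hk : Integrable k volume)
    (H : ∀ t : ℝ, ∑' δ : ℝ, c δ * cexp (t * δ * I) + ∫ s : ℝ, k s * cexp (t * s * I) = 0) :
    (∀ δ, c δ = 0) ∧ k =ᵐ[volume] 0 := by
  have hn : ∀ t x : ℝ, ‖cexp (t * x * I)‖ = 1 := fun t x => by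
    rw [← ofReal_mul, norm_exp_ofReal_mul_I]
  have s1 : ∀ (t : ℝ) (v : ℝ → ℂ), (∀ δ, ‖v δ‖ ≤ ‖c δ‖) →
      Summable fun δ : ℝ => v δ * cexp (t * δ * I) := fun t v hv => by
    refine Summable.of_norm_bounded hc fun δ => ?_
    rw [norm_mul, hn, mul_one]
    exact hv δ
  have i1 : ∀ (t : ℝ) (v : ℝ → ℂ), Integrable v volume →
      Integrable (fun s : ℝ => v s * cexp (t * s * I)) volume := fun t v hv => by
    refine Integrable.mul_bdd (c := 1) hv (by fun_prop) ?_
    exact Filter.Eventually.of_forall fun s => (hn t s).le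
  have hk' : Integrable (fun s => (starRingEnd ℂ) (k s)) volume := by
    exact (integrable_norm_iff (by exact continuous_conj.comp_aestronglyMeasurable hk.1)).1
      (by simpa using hk.norm)
  have H' : ∀ t : ℝ, ∑' δ : ℝ, (starRingEnd ℂ) (c δ) * cexp (t * δ * I) +
      ∫ s : ℝ, (starRingEnd ℂ) (k s) * cexp (t * s * I) = 0 := fun t => by
    have h := congrArg (starRingEnd ℂ) (H (-t))
    rw [map_zero, map_add, conj_tsum, ← integral_conj] at h
    rw [← h]
    congr 1
    · refine tsum_congr fun δ => ?_
      rw [map_mul, ← exp_conj]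
      simp
    · refine integral_congr_ae (Filter.Eventually.of_forall fun s => ?_)
      simp only [map_mul, ← exp_conj]
      simp
  have comb : ∀ (a b : ℂ) (t : ℝ),
      ∑' δ : ℝ, (a * c δ + b * (starRingEnd ℂ) (c δ)) * cexp (t * δ * I) +
      ∫ s : ℝ, (a * k s + b * (starRingEnd ℂ) (k s)) * cexp (t * s * I) = 0 := fun a b t => by
    simp only [add_mul, mul_assoc a, mul_assoc b]
    rw [((s1 t c fun _ => le_rfl).mul_left a).tsum_add
      ((s1 t (fun δ => (starRingEnd ℂ) (c δ)) fun _ => by simp).mul_left b),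
      tsum_mul_left, tsum_mul_left,
      integral_add ((i1 t k hk).const_mul a) ((i1 t _ hk').const_mul b),
      integral_const_mul, integral_const_mul]
    linear_combination a * H t + b * H' t
  have hre := real_unique (u := fun δ => (c δ).re) (h := fun s => (k s).re)
    (Summable.of_nonneg_of_le (fun _ => abs_nonneg _) (fun δ => abs_re_le_norm _) hc) hk.re
    (fun t => by
      rw [← comb (1 / 2) (1 / 2) t]
      simp only [re_eq_add_conj]
      congr 1
      · refine tsum_congr fun δ => ?_
        ring
      · refine integral_congr_ae (Filter.Eventually.of_forall fun s => ?_)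
        ring)
  have him := real_unique (u := fun δ => (c δ).im) (h := fun s => (k s).im)
    (Summable.of_nonneg_of_le (fun _ => abs_nonneg _) (fun δ => abs_im_le_norm _) hc) hk.im
    (fun t => by
      rw [← comb (1 / (2 * I)) (-1 / (2 * I)) t]
      simp only [im_eq_sub_conj]
      congr 1
      · refine tsum_congr fun δ => ?_
        ring
      · refine integral_congr_ae (Filter.Eventually.of_forall fun s => ?_)
        ring)
  refine ⟨fun δ => Complex.ext (hre.1 δ) (him.1 δ), ?_⟩
  filter_upwards [hre.2, him.2] with s h1 h2
  exact Complex.ext h1 h2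

/-- The symbol determines the coefficients and, almost everywhere, the kernel. -/
lemma Rep.unique {r₁ r₂ : Rep} (h : r₁.symbol = r₂.symbol) :
    r₁.coeff = r₂.coeff ∧ r₁.kernel =ᵐ[volume] r₂.kernel := by
  have hn : ∀ t x : ℝ, ‖cexp (I * t * x)‖ = 1 := fun t x => by
    rw [mul_assoc, ← ofReal_mul, mul_comm, norm_exp_ofReal_mul_I]
  have s1 : ∀ (t : ℝ) (r : Rep),
      Summable fun δ : ℝ => r.coeff δ * cexp (I * δ * t) := fun t r => by
    refine Summable.of_norm_bounded r.summable_coeff fun δ => ?_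
    rw [norm_mul, hn, mul_one]
  have i1 : ∀ (t : ℝ) (r : Rep),
      Integrable (fun s : ℝ => r.kernel s * cexp (I * t * s)) volume := fun t r => by
    refine Integrable.mul_bdd (c := 1) r.integrable_kernel (by fun_prop) ?_
    exact Filter.Eventually.of_forall fun s => (hn t s).le
  have key := complex_unique (c := fun δ => r₁.coeff δ - r₂.coeff δ)
    (k := fun s => r₁.kernel s - r₂.kernel s)
    (Summable.of_nonneg_of_le (fun _ => norm_nonneg _) (fun δ => norm_sub_le _ _)
      (r₁.summable_coeff.add r₂.summable_coeff))
    (r₁.integrable_kernel.sub r₂.integrable_kernel)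
    (fun t => by
      have ht := congrFun h t
      unfold Rep.symbol at ht
      have e1 : ∀ x : ℝ, (t : ℂ) * x * I = I * x * t := fun x => by ring
      have e2 : ∀ x : ℝ, I * (x : ℂ) * t = I * t * x := fun x => by ring
      simp only [sub_mul, e1]
      rw [(s1 t r₁).tsum_sub (s1 t r₂)]
      simp only [e2] at ht ⊢
      rw [integral_sub (i1 t r₁) (i1 t r₂)]
      linear_combination ht)
  refine ⟨funext fun δ => sub_eq_zero.1 (key.1 δ), ?_⟩
  filter_upwards [key.2] with s hs
  exact sub_eq_zero.1 hs

/-! ### Convolution by an integrable function on `L^p(ℝ)` -/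

/-- `(k * f)(t) = ∫ k(t - s) f(s) ds`. -/
noncomputable def convFun (k f : ℝ → ℂ) (t : ℝ) : ℂ := ∫ s : ℝ, k (t - s) * f s

lemma aesm_integrand {k f : ℝ → ℂ} (hk : AEStronglyMeasurable k volume)
    (hf : AEStronglyMeasurable f volume) :
    AEStronglyMeasurable (fun x : ℝ × ℝ => k (x.1 - x.2) * f x.2) (volume.prod volume) := by
  have := AEStronglyMeasurable.convolution_integrand (μ := (volume : Measure ℝ))
    (ν := (volume : Measure ℝ)) (ContinuousLinearMap.mul ℂ ℂ) hf hk
  simpa [mul_comm] using this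

/-- The convolution of absolute values. -/
noncomputable def absConv (k f : ℝ → ℂ) (t : ℝ) : ℝ≥0∞ := ∫⁻ s : ℝ, ‖k (t - s)‖ₑ * ‖f s‖ₑ

lemma aemeasurable_absConv {k f : ℝ → ℂ} (hk : AEStronglyMeasurable k volume)
    (hf : AEStronglyMeasurable f volume) : AEMeasurable (absConv k f) volume := by
  have h := (aesm_integrand hk hf).enorm.lintegral_prod_right'
  simpa only [enorm_mul] using! h

lemma ae_aesm_slice {k f : ℝ → ℂ} (hk : AEStronglyMeasurable k volume)
    (hf : AEStronglyMeasurable f volume) (t : ℝ) :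
    AEStronglyMeasurable (fun s => k (t - s) * f s) volume := by
  refine AEStronglyMeasurable.mul ?_ hf
  exact hk.comp_quasiMeasurePreserving (Measure.measurePreserving_sub_left volume t).quasiMeasurePreserving

lemma lintegral_slice {k : ℝ → ℂ} (t : ℝ) :
    ∫⁻ s : ℝ, ‖k (t - s)‖ₑ = ∫⁻ s : ℝ, ‖k s‖ₑ :=
  lintegral_sub_left_eq_self (fun s => ‖k s‖ₑ) t

/-- Young's inequality for the convolution of absolute values. -/
lemma eLpNorm_absConv_le {k f : ℝ → ℂ} {p : ℝ≥0∞} (hp : 1 ≤ p)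
    (hk : AEStronglyMeasurable k volume) (hf : AEStronglyMeasurable f volume) :
    eLpNorm (absConv k f) p volume ≤ eLpNorm k 1 volume * eLpNorm f p volume := by
  rw [eLpNorm_one_eq_lintegral_enorm]
  rcases eq_or_ne p ∞ with rfl | hpt
  · rw [eLpNorm_exponent_top, eLpNorm_exponent_top]
    refine eLpNormEssSup_le_of_ae_enorm_bound (Filter.Eventually.of_forall fun t => ?_)
    simp only [enorm_eq_self]
    calc absConv k f t ≤ ∫⁻ s : ℝ, ‖k (t - s)‖ₑ * eLpNormEssSup f volume := by
          refine lintegral_mono_ae ?_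
          filter_upwards [enorm_ae_le_eLpNormEssSup f volume] with s hs
          gcongr
      _ = _ := by
          rw [lintegral_mul_const'', lintegral_slice]
          exact (hk.comp_quasiMeasurePreserving
            (Measure.measurePreserving_sub_left volume t).quasiMeasurePreserving).enorm
  · have hp0 : p ≠ 0 := (zero_lt_one.trans_le hp).ne'
    set q := p.toReal with hq
    have hq1 : 1 ≤ q := by
      have := ENNReal.toReal_mono hpt hp
      simpa using this
    have hq0 : 0 < q := by linarith
    set K := ∫⁻ s : ℝ, ‖k s‖ₑ with hK
    rw [eLpNorm_eq_lintegral_rpow_enorm_toReal hp0 hpt, eLpNorm_eq_lintegral_rpow_enorm_toReal hp0 hpt,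
      ← hq]
    simp only [enorm_eq_self]
    have key : ∀ t, absConv k f t ^ q ≤ K ^ (q - 1) * ∫⁻ s : ℝ, ‖k (t - s)‖ₑ * ‖f s‖ₑ ^ q := by
      intro t
      have hkm : AEMeasurable (fun s => ‖k (t - s)‖ₑ) volume :=
        (hk.comp_quasiMeasurePreserving
          (Measure.measurePreserving_sub_left volume t).quasiMeasurePreserving).enorm
      have h := ENNReal.lintegral_mul_norm_pow_le (μ := volume) (f := fun s => ‖k (t - s)‖ₑ)
        (g := fun s => ‖k (t - s)‖ₑ * ‖f s‖ₑ ^ q) hkm (hkm.mul (hf.enorm.pow_const q))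
        (p := 1 - 1 / q) (q := 1 / q)
        (by rw [sub_nonneg, div_le_one hq0]; exact hq1) (by positivity) (by ring)
      have h2 : absConv k f t = ∫⁻ a, ‖k (t - a)‖ₑ ^ (1 - 1 / q) *
          (‖k (t - a)‖ₑ * ‖f a‖ₑ ^ q) ^ (1 / q) := by
        refine lintegral_congr fun a => ?_
        rw [ENNReal.mul_rpow_of_nonneg _ _ (by positivity), ← ENNReal.rpow_mul,
          mul_one_div_cancel hq0.ne', ENNReal.rpow_one, ← mul_assoc,
          ← ENNReal.rpow_add_of_nonneg _ _
            (by rw [sub_nonneg, div_le_one hq0]; exact hq1) (by positivity)]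
        simp
      rw [← h2, lintegral_slice, ← hK] at h
      calc absConv k f t ^ q ≤ (K ^ (1 - 1 / q) *
            (∫⁻ s : ℝ, ‖k (t - s)‖ₑ * ‖f s‖ₑ ^ q) ^ (1 / q)) ^ q := by gcongr
        _ = _ := by
          rw [ENNReal.mul_rpow_of_nonneg _ _ hq0.le, ← ENNReal.rpow_mul, ← ENNReal.rpow_mul,
            one_div_mul_cancel hq0.ne', ENNReal.rpow_one]
          congr 2
          field_simp
    have hfq : AEMeasurable (fun s => ‖f s‖ₑ ^ q) volume := hf.enorm.pow_const q
    have hprod : AEMeasurable (fun x : ℝ × ℝ => ‖k (x.1 - x.2)‖ₑ * ‖f x.2‖ₑ ^ q)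
        (volume.prod volume) := by
      refine AEMeasurable.mul ?_ ?_
      · exact (hk.comp_quasiMeasurePreserving
          (quasiMeasurePreserving_sub_of_right_invariant volume volume)).enorm
      · exact hfq.comp_quasiMeasurePreserving Measure.quasiMeasurePreserving_snd
    have hint : ∫⁻ t, absConv k f t ^ q ≤ K ^ q * ∫⁻ s, ‖f s‖ₑ ^ q := by
      calc ∫⁻ t, absConv k f t ^ q
          ≤ ∫⁻ t : ℝ, K ^ (q - 1) * ∫⁻ s : ℝ, ‖k (t - s)‖ₑ * ‖f s‖ₑ ^ q := lintegral_mono key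
        _ = K ^ (q - 1) * ∫⁻ t : ℝ, ∫⁻ s : ℝ, ‖k (t - s)‖ₑ * ‖f s‖ₑ ^ q :=
            lintegral_const_mul'' _ hprod.lintegral_prod_right'
        _ = K ^ (q - 1) * ∫⁻ s : ℝ, ∫⁻ t : ℝ, ‖k (t - s)‖ₑ * ‖f s‖ₑ ^ q := by
            rw [lintegral_lintegral_swap hprod]
        _ = K ^ (q - 1) * (K * ∫⁻ s, ‖f s‖ₑ ^ q) := by
            congr 1
            rw [← lintegral_const_mul'' _ hfq]
            refine lintegral_congr fun s => ?_
            rw [lintegral_mul_const'', lintegral_sub_right_eq_self (fun t => ‖k t‖ₑ) s]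
            exact (hk.comp_quasiMeasurePreserving
              (measurePreserving_sub_right volume s).quasiMeasurePreserving).enorm
        _ = K ^ q * ∫⁻ s, ‖f s‖ₑ ^ q := by
            rw [← mul_assoc]
            congr 1
            nth_rewrite 2 [← ENNReal.rpow_one K]
            rw [← ENNReal.rpow_add_of_nonneg _ _ (by linarith) zero_le_one]
            simp
    calc (∫⁻ t, absConv k f t ^ q) ^ (1 / q) ≤ (K ^ q * ∫⁻ s, ‖f s‖ₑ ^ q) ^ (1 / q) := by gcongr
      _ = _ := by
        rw [ENNReal.mul_rpow_of_nonneg _ _ (by positivity), ← ENNReal.rpow_mul,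
          mul_one_div_cancel hq0.ne', ENNReal.rpow_one]

lemma ae_integrable_slice {k f : ℝ → ℂ} {p : ℝ≥0∞} (hp : 1 ≤ p) (hk : Integrable k volume)
    (hf : MemLp f p volume) : ∀ᵐ t : ℝ, Integrable (fun s => k (t - s) * f s) volume := by
  have hfin : eLpNorm (absConv k f) p volume < ∞ :=
    (eLpNorm_absConv_le hp hk.1 hf.1).trans_lt
      (ENNReal.mul_lt_top (memLp_one_iff_integrable.2 hk).2 hf.2)
  have h : ∀ᵐ t : ℝ, absConv k f t < ∞ := by
    have hp0 : p ≠ 0 := (zero_lt_one.trans_le hp).ne'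
    rcases eq_or_ne p ∞ with rfl | hpt
    · rw [eLpNorm_exponent_top] at hfin
      filter_upwards [enorm_ae_le_eLpNormEssSup (absConv k f) volume] with t ht
      exact lt_of_le_of_lt (by simpa using ht) hfin
    · have h1 := lintegral_rpow_enorm_lt_top_of_eLpNorm_lt_top hp0 hpt hfin
      have h2 := ae_lt_top' (by
        simp only [enorm_eq_self]
        exact (aemeasurable_absConv hk.1 hf.1).pow_const _) h1.ne
      filter_upwards [h2] with t ht
      simp only [enorm_eq_self] at ht
      by_contra hcon
      rw [not_lt, top_le_iff] at hcon
      rw [hcon, ENNReal.top_rpow_of_pos (ENNReal.toReal_pos hp0 hpt)] at ht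
      exact lt_irrefl _ ht
  filter_upwards [h] with t ht
  refine ⟨ae_aesm_slice hk.1 hf.1 t, ?_⟩
  simpa only [HasFiniteIntegral, enorm_mul, absConv] using ht

lemma eLpNorm_convFun_le {k f : ℝ → ℂ} {p : ℝ≥0∞} (hp : 1 ≤ p)
    (hk : AEStronglyMeasurable k volume) (hf : AEStronglyMeasurable f volume) :
    eLpNorm (convFun k f) p volume ≤ eLpNorm k 1 volume * eLpNorm f p volume := by
  refine le_trans (eLpNorm_mono_enorm fun t => ?_) (eLpNorm_absConv_le hp hk hf)
  rw [enorm_eq_self]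
  refine (enorm_integral_le_lintegral_enorm _).trans (le_of_eq ?_)
  simp only [enorm_mul, absConv]

lemma memLp_convFun {k f : ℝ → ℂ} {p : ℝ≥0∞} (hp : 1 ≤ p) (hk : Integrable k volume)
    (hf : MemLp f p volume) : MemLp (convFun k f) p volume := by
  refine ⟨(aesm_integrand hk.1 hf.1).integral_prod_right', ?_⟩
  exact (eLpNorm_convFun_le hp hk.1 hf.1).trans_lt
    (ENNReal.mul_lt_top (memLp_one_iff_integrable.2 hk).2 hf.2)

lemma convFun_congr {k f g : ℝ → ℂ} (h : f =ᵐ[volume] g) : convFun k f = convFun k g := by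
  funext t
  refine integral_congr_ae ?_
  filter_upwards [h] with s hs
  rw [hs]

lemma convFun_congr_left {k l : ℝ → ℂ} (h : k =ᵐ[volume] l) (f : ℝ → ℂ) :
    convFun k f = convFun l f := by
  funext t
  refine integral_congr_ae ?_
  filter_upwards [(Measure.measurePreserving_sub_left volume t).quasiMeasurePreserving.ae_eq h]
    with s hs
  simp only [Function.comp_apply] at hs
  rw [hs]

section Operators

variable (p : ℝ≥0∞) [Fact (1 ≤ p)]

/-- Convolution with an integrable function `k`, as a linear map on `L^p(ℝ)`. -/
noncomputable def convₗ (k : ℝ → ℂ) (hk : Integrable k volume) :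
    Lp ℂ p (volume : Measure ℝ) →ₗ[ℂ] Lp ℂ p (volume : Measure ℝ) where
  toFun f := (memLp_convFun Fact.out hk (Lp.memLp f)).toLp (convFun k f)
  map_add' f g := by
    rw [← MemLp.toLp_add, MemLp.toLp_eq_toLp_iff, convFun_congr (Lp.coeFn_add f g)]
    filter_upwards [ae_integrable_slice (p := p) Fact.out hk (Lp.memLp f),
      ae_integrable_slice (p := p) Fact.out hk (Lp.memLp g)] with t h1 h2
    simp only [convFun, Pi.add_apply, mul_add]
    exact integral_add h1 h2
  map_smul' c f := by
    rw [RingHom.id_apply, ← MemLp.toLp_const_smul, MemLp.toLp_eq_toLp_iff,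
      convFun_congr (Lp.coeFn_smul c f)]
    refine Filter.Eventually.of_forall fun t => ?_
    simp only [convFun, Pi.smul_apply, smul_eq_mul, mul_left_comm _ c]
    exact integral_const_mul c _

lemma norm_convₗ_le (k : ℝ → ℂ) (hk : Integrable k volume)
    (f : Lp ℂ p (volume : Measure ℝ)) :
    ‖convₗ p k hk f‖ ≤ (eLpNorm k 1 volume).toReal * ‖f‖ := by
  have h : ‖convₗ p k hk f‖ = (eLpNorm (convFun k f) p volume).toReal :=
    Lp.norm_toLp _ (memLp_convFun Fact.out hk (Lp.memLp f))
  rw [h, Lp.norm_def, ← ENNReal.toReal_mul]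
  exact ENNReal.toReal_mono
    (ENNReal.mul_ne_top (memLp_one_iff_integrable.2 hk).2.ne (Lp.memLp f).2.ne)
    (eLpNorm_convFun_le Fact.out hk.1 (Lp.memLp f).1)

/-- Convolution with an integrable function `k`, as a bounded operator on `L^p(ℝ)`. -/
noncomputable def conv (k : ℝ → ℂ) (hk : Integrable k volume) :
    Lp ℂ p (volume : Measure ℝ) →L[ℂ] Lp ℂ p (volume : Measure ℝ) :=
  (convₗ p k hk).mkContinuous _ (norm_convₗ_le p k hk)

/-- The translation `f ↦ f(· - δ)` on `L^p(ℝ)`. -/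
noncomputable def translation (δ : ℝ) :
    Lp ℂ p (volume : Measure ℝ) →L[ℂ] Lp ℂ p (volume : Measure ℝ) :=
  (Lp.compMeasurePreservingₗᵢ ℂ (fun t : ℝ => t - δ)
    (measurePreserving_sub_right volume δ)).toContinuousLinearMap

/-- The reflection `(J f)(t) = f(-t)` on `L^p(ℝ)`. -/
noncomputable def reflection :
    Lp ℂ p (volume : Measure ℝ) →L[ℂ] Lp ℂ p (volume : Measure ℝ) :=
  (Lp.compMeasurePreservingₗᵢ ℂ (fun t : ℝ => -t)
    (Measure.measurePreserving_neg volume)).toContinuousLinearMap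

/-- The projection `P f = χ_{(0,∞)} f`, as a linear map on `L^p(ℝ)`. -/
noncomputable def projPₗ :
    Lp ℂ p (volume : Measure ℝ) →ₗ[ℂ] Lp ℂ p (volume : Measure ℝ) where
  toFun f := ((Lp.memLp f).indicator (measurableSet_Ioi (a := (0 : ℝ)))).toLp
    ((Set.Ioi (0 : ℝ)).indicator f)
  map_add' f g := by
    rw [← MemLp.toLp_add, MemLp.toLp_eq_toLp_iff, ← Set.indicator_add']
    filter_upwards [Lp.coeFn_add f g] with t h
    simp only [Set.indicator]
    split_ifs
    · exact h
    · rfl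
  map_smul' c f := by
    rw [RingHom.id_apply, ← MemLp.toLp_const_smul, MemLp.toLp_eq_toLp_iff]
    filter_upwards [Lp.coeFn_smul c f] with t h
    rw [Pi.smul_apply]
    simp only [Set.indicator, h, Pi.smul_apply]
    split_ifs <;> simp

lemma norm_projPₗ_le (f : Lp ℂ p (volume : Measure ℝ)) : ‖projPₗ p f‖ ≤ 1 * ‖f‖ := by
  have hf := (Lp.memLp f).indicator (measurableSet_Ioi (a := (0 : ℝ)))
  have h : projPₗ p f = hf.toLp _ := rfl
  rw [h, Lp.norm_toLp, Lp.norm_def, one_mul]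
  exact ENNReal.toReal_mono (Lp.memLp f).2.ne (eLpNorm_indicator_le _)

/-- The projection `P f = χ_{(0,∞)} f` on `L^p(ℝ)`. -/
noncomputable def projP :
    Lp ℂ p (volume : Measure ℝ) →L[ℂ] Lp ℂ p (volume : Measure ℝ) :=
  (projPₗ p).mkContinuous 1 (norm_projPₗ_le p)

/-- The complementary projection `Q = I - P`. -/
noncomputable def projQ :
    Lp ℂ p (volume : Measure ℝ) →L[ℂ] Lp ℂ p (volume : Measure ℝ) :=
  ContinuousLinearMap.id ℂ _ - projP p

/-- The operator `f ↦ ∑_δ a_δ f(· - δ) + ∫ k(· - s) f(s) ds` on `L^p(ℝ)`; the series converges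
absolutely in the operator norm. -/
noncomputable def Rep.op (r : Rep) :
    Lp ℂ p (volume : Measure ℝ) →L[ℂ] Lp ℂ p (volume : Measure ℝ) :=
  ∑' δ : ℝ, r.coeff δ • translation p δ + conv p r.kernel r.integrable_kernel

open Classical in
/-- The operator `W⁰(a)` on `L^p(ℝ)` generated by `a ∈ G`. It does not depend on the
representation of `a`, see `W0_symbol`. (The value for `a ∉ G` is irrelevant.) -/
noncomputable def W0 (a : ℝ → ℂ) :
    Lp ℂ p (volume : Measure ℝ) →L[ℂ] Lp ℂ p (volume : Measure ℝ) :=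
  if h : a ∈ G then (Classical.choose h).op p else 0

lemma Rep.op_congr {r₁ r₂ : Rep} (h : r₁.symbol = r₂.symbol) : r₁.op p = r₂.op p := by
  obtain ⟨hc, hk⟩ := Rep.unique h
  have : conv p r₁.kernel r₁.integrable_kernel = conv p r₂.kernel r₂.integrable_kernel := by
    refine ContinuousLinearMap.ext fun f => ?_
    have e : ∀ r : Rep, conv p r.kernel r.integrable_kernel f =
      (memLp_convFun Fact.out r.integrable_kernel (Lp.memLp f)).toLp (convFun r.kernel f) :=
      fun _ => rfl
    rw [e, e, MemLp.toLp_eq_toLp_iff, convFun_congr_left hk]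
  unfold Rep.op
  rw [hc, this]

/-- `W⁰(a)` is given by the formula with any representation of `a`. -/
theorem W0_symbol (r : Rep) : W0 p r.symbol = r.op p := by
  have h : r.symbol ∈ G := ⟨r, rfl⟩
  rw [W0, dif_pos h]
  exact Rep.op_congr p (Classical.choose_spec h)

/-- `L^p(ℝ⁺)` as the subspace of functions in `L^p(ℝ)` that vanish on the negative semi-axis. -/
noncomputable def LpPlus : Submodule ℂ (Lp ℂ p (volume : Measure ℝ)) where
  carrier := {f | ∀ᵐ t : ℝ, t < 0 → f t = 0}
  add_mem' {f g} hf hg := by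
    change ∀ᵐ t : ℝ, t < 0 → f t = 0 at hf
    change ∀ᵐ t : ℝ, t < 0 → g t = 0 at hg
    change ∀ᵐ t : ℝ, t < 0 → (f + g) t = 0
    filter_upwards [hf, hg, Lp.coeFn_add f g] with t h1 h2 h3 ht
    rw [h3, Pi.add_apply, h1 ht, h2 ht, add_zero]
  zero_mem' := by
    filter_upwards [Lp.coeFn_zero ℂ p (volume : Measure ℝ)] with t h ht
    exact h
  smul_mem' c f hf := by
    change ∀ᵐ t : ℝ, t < 0 → f t = 0 at hf
    change ∀ᵐ t : ℝ, t < 0 → (c • f) t = 0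
    filter_upwards [hf, Lp.coeFn_smul c f] with t h1 h3 ht
    rw [h3, Pi.smul_apply, h1 ht, smul_zero]

lemma projP_coe (f : Lp ℂ p (volume : Measure ℝ)) :
    projP p f =ᵐ[volume] (Set.Ioi (0 : ℝ)).indicator f := by
  have h := (Lp.memLp f).indicator (measurableSet_Ioi (a := (0 : ℝ)))
  have h' : projP p f = h.toLp _ := rfl
  rw [h']
  exact h.coeFn_toLp

lemma reflection_coe (f : Lp ℂ p (volume : Measure ℝ)) :
    reflection p f =ᵐ[volume] fun t => f (-t) :=
  Lp.coeFn_compMeasurePreserving f (Measure.measurePreserving_neg volume)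

lemma projP_mem (f : Lp ℂ p (volume : Measure ℝ)) : projP p f ∈ LpPlus p := by
  change ∀ᵐ t : ℝ, t < 0 → projP p f t = 0
  filter_upwards [projP_coe p f] with t h ht
  rw [h, Set.indicator_of_notMem (by simpa using ht.le)]

lemma reflection_projQ_mem (f : Lp ℂ p (volume : Measure ℝ)) :
    reflection p (projQ p f) ∈ LpPlus p := by
  change ∀ᵐ t : ℝ, t < 0 → reflection p (projQ p f) t = 0
  have h1 : ∀ᵐ t : ℝ, 0 < t → projQ p f t = 0 := by
    filter_upwards [projP_coe p f, Lp.coeFn_sub f (projP p f)] with t h h' ht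
    have : projQ p f = f - projP p f := rfl
    rw [this, h', Pi.sub_apply, h, Set.indicator_of_mem (by simpa using ht), sub_self]
  have h2 := (Measure.measurePreserving_neg (volume : Measure ℝ)).quasiMeasurePreserving.ae h1
  filter_upwards [reflection_coe p (projQ p f), h2] with t h h' ht
  rw [h, h' (by simpa using ht)]

/-- The Wiener-Hopf operator `W(a) = P W⁰(a)` on `L^p(ℝ⁺)`. -/
noncomputable def W (a : ℝ → ℂ) : LpPlus p →L[ℂ] LpPlus p :=
  ((projP p ∘L W0 p a) ∘L (LpPlus p).subtypeL).codRestrict (LpPlus p) fun _ => projP_mem p _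

/-- The operator `𝐏(g) = J Q W⁰(g) P` restricted to `ker W(g)` (`P` acts there as the identity);
its values lie in `L^p(ℝ⁺)`. -/
noncomputable def matchingOp (g : ℝ → ℂ) : (W p g).ker →ₗ[ℂ] LpPlus p :=
  LinearMap.codRestrict (LpPlus p)
    ((reflection p ∘L projQ p ∘L W0 p g ∘L projP p : Lp ℂ p (volume : Measure ℝ) →L[ℂ] _).toLinearMap
      ∘ₗ (LpPlus p).subtype ∘ₗ (W p g).ker.subtype)
    fun _ => reflection_projQ_mem p _

/-- `𝐏^±(g) = (1/2)(I ± 𝐏(g))` on `ker W(g)`, where `ε = 1` is the sign `+` and `ε = -1` is the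
sign `-`. -/
noncomputable def matchingProj (g : ℝ → ℂ) (ε : ℂ) : (W p g).ker →ₗ[ℂ] LpPlus p :=
  (1 / 2 : ℂ) • ((W p g).ker.subtype + ε • matchingOp p g)

end Operators

/-! ### The functions `ψ_j` -/

/-- The normalized Laguerre polynomials
`Λ_j(x) = ∑_{i ≤ j} (j choose i) (-1)^i x^i / i!` (orthonormal for the weight `e^{-x}` on
`(0, ∞)`). -/
noncomputable def laguerre (j : ℕ) (x : ℝ) : ℝ :=
  ∑ i ∈ Finset.range (j + 1), (j.choose i : ℝ) * (-1) ^ i / (i.factorial : ℝ) * x ^ i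

/-- `ψ_j(t) = √2 e^{-t} Λ_j(2t)` for `t > 0` and `ψ_j(t) = 0` otherwise. -/
noncomputable def psiFun (j : ℕ) (t : ℝ) : ℂ :=
  (Set.Ioi (0 : ℝ)).indicator (fun t => ((√2 * Real.exp (-t) * laguerre j (2 * t) : ℝ) : ℂ)) t

lemma memLp_exp (p : ℝ≥0∞) :
    MemLp ((Set.Ioi (0 : ℝ)).indicator fun t => Real.exp (-(1 / 2) * t)) p volume := by
  have hm : AEStronglyMeasurable
      ((Set.Ioi (0 : ℝ)).indicator fun t => Real.exp (-(1 / 2) * t)) volume :=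
    (Continuous.aestronglyMeasurable (by fun_prop)).indicator measurableSet_Ioi
  rcases eq_or_ne p 0 with rfl | hp0
  · exact memLp_zero_iff_aestronglyMeasurable.2 hm
  rcases eq_or_ne p ∞ with rfl | hpt
  · refine memLp_top_of_bound hm 1 (Filter.Eventually.of_forall fun t => ?_)
    by_cases ht : t ∈ Set.Ioi (0 : ℝ)
    · rw [Set.indicator_of_mem ht, Real.norm_eq_abs, Real.abs_exp, Real.exp_le_one_iff]
      have : 0 < t := ht
      linarith
    · simp [Set.indicator_of_notMem ht]
  · have hq : 0 < p.toReal := ENNReal.toReal_pos hp0 hpt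
    refine (integrable_norm_rpow_iff hm hp0 hpt).1 ?_
    have h := (integrable_indicator_iff measurableSet_Ioi).2
      (exp_neg_integrableOn_Ioi 0 (b := p.toReal / 2) (by positivity))
    refine h.congr (Filter.Eventually.of_forall fun t => ?_)
    by_cases ht : t ∈ Set.Ioi (0 : ℝ)
    · simp only [Set.indicator_of_mem ht, Real.norm_eq_abs, Real.abs_exp]
      rw [← Real.exp_mul]
      congr 1
      ring
    · simp only [Set.indicator_of_notMem ht, norm_zero]
      rw [Real.zero_rpow hq.ne']

lemma exp_mul_laguerre_bound (j : ℕ) : ∃ C : ℝ, ∀ t : ℝ, 0 < t →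
    |√2 * Real.exp (-t) * laguerre j (2 * t)| ≤ C * Real.exp (-(1 / 2) * t) := by
  have h1 : ∀ (i : ℕ) (t : ℝ), 0 < t →
      (2 * t) ^ i ≤ (4 : ℝ) ^ i * i.factorial * Real.exp (t / 2) := fun i t ht => by
    have h := Real.pow_div_factorial_le_exp (x := t / 2) (by positivity) i
    rw [div_le_iff₀ (by positivity)] at h
    calc (2 * t) ^ i = 4 ^ i * (t / 2) ^ i := by rw [← mul_pow]; ring
      _ ≤ 4 ^ i * (Real.exp (t / 2) * i.factorial) := by gcongr
      _ = _ := by ring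
  refine ⟨√2 * ∑ i ∈ Finset.range (j + 1),
    |(j.choose i : ℝ) * (-1) ^ i / (i.factorial : ℝ)| * ((4 : ℝ) ^ i * i.factorial),
    fun t ht => ?_⟩
  have h2 : |laguerre j (2 * t)| ≤ (∑ i ∈ Finset.range (j + 1),
      |(j.choose i : ℝ) * (-1) ^ i / (i.factorial : ℝ)| * ((4 : ℝ) ^ i * i.factorial)) *
      Real.exp (t / 2) := by
    unfold laguerre
    refine (Finset.abs_sum_le_sum_abs _ _).trans ?_
    rw [Finset.sum_mul]
    refine Finset.sum_le_sum fun i _ => ?_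
    rw [abs_mul, abs_of_nonneg (by positivity : (0 : ℝ) ≤ (2 * t) ^ i), mul_assoc]
    exact mul_le_mul_of_nonneg_left (h1 i t ht) (abs_nonneg _)
  rw [abs_mul, abs_of_nonneg (by positivity : (0 : ℝ) ≤ √2 * Real.exp (-t))]
  refine (mul_le_mul_of_nonneg_left h2 (by positivity)).trans (le_of_eq ?_)
  have h3 : Real.exp (-(1 / 2) * t) = Real.exp (-t) * Real.exp (t / 2) := by
    rw [← Real.exp_add]
    congr 1
    ring
  rw [h3]
  ring

lemma memLp_psiFun (p : ℝ≥0∞) (j : ℕ) : MemLp (psiFun j) p volume := by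
  obtain ⟨C, hC⟩ := exp_mul_laguerre_bound j
  refine ((memLp_exp p).const_mul C).mono ?_ (Filter.Eventually.of_forall fun t => ?_)
  · refine (Continuous.aestronglyMeasurable ?_).indicator measurableSet_Ioi
    unfold laguerre
    fun_prop
  · unfold psiFun
    by_cases ht : t ∈ Set.Ioi (0 : ℝ)
    · simp only [Set.indicator_of_mem ht]
      rw [norm_real, Real.norm_eq_abs]
      exact (hC t ht).trans (le_abs_self _)
    · simp [Set.indicator_of_notMem ht]

/-- `ψ_j` as an element of `L^p(ℝ⁺)`. -/
noncomputable def psi (p : ℝ≥0∞) (j : ℕ) : LpPlus p :=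
  ⟨(memLp_psiFun p j).toLp (psiFun j), by
    change ∀ᵐ t : ℝ, t < 0 → (memLp_psiFun p j).toLp (psiFun j) t = 0
    filter_upwards [(memLp_psiFun p j).coeFn_toLp] with t h ht
    rw [h, psiFun, Set.indicator_of_notMem (by simpa using ht.le)]⟩

/-! ### Factorization and the two systems of functions -/

/-- `g = g₋ ((t - i)/(t + i))^κ g₊` with `g₋^{±1} ∈ G⁻`, `g₊^{±1} ∈ G⁺` and `g₋(0) = 1`: the
(normalized) Wiener-Hopf factorization in the case without exponential factor. -/
structure IsFactorization (g gm gp : ℝ → ℂ) (κ : ℤ) : Prop where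
  minus_mem : gm ∈ GMinus
  minus_ne_zero : ∀ t, gm t ≠ 0
  minus_inv_mem : gm⁻¹ ∈ GMinus
  plus_mem : gp ∈ GPlus
  plus_ne_zero : ∀ t, gp t ≠ 0
  plus_inv_mem : gp⁻¹ ∈ GPlus
  minus_zero : gm 0 = 1
  eq_mul : ∀ t : ℝ, g t = gm t * ((t - I) / (t + I)) ^ κ * gp t

/-- The number `σ(g) = (-1)^n g(0)`. -/
noncomputable def sigma (g : ℝ → ℂ) (n : ℕ) : ℂ := (-1) ^ n * g 0

/-- For `n = 2m`: the vectors `W(g₊⁻¹)(ψ_{m-k-1} - ε σ ψ_{m+k})`, `k = 0, …, m-1`. -/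
noncomputable def evenSystem (p : ℝ≥0∞) [Fact (1 ≤ p)] (gp : ℝ → ℂ) (σ ε : ℂ) (m : ℕ)
    (k : Fin m) : LpPlus p :=
  W p gp⁻¹ (psi p (m - k - 1) - (ε * σ) • psi p (m + k))

/-- For `n = 2m + 1`: the vectors `W(g₊⁻¹)(ψ_{m+k} - ε σ ψ_{m-k})`, `k = 0, …, m`. -/
noncomputable def oddSystem (p : ℝ≥0∞) [Fact (1 ≤ p)] (gp : ℝ → ℂ) (σ ε : ℂ) (m : ℕ)
    (k : Fin (m + 1)) : LpPlus p :=
  W p gp⁻¹ (psi p (m + k) - (ε * σ) • psi p (m - k))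

end WienerHopf

/-! The map a ↦ W⁰(a) is multiplicative on G, and conjugation by the reflection J turns W⁰(a) into
W⁰(ã). Symbols in G⁺ give operators preserving L^p(ℝ⁺); symbols in G⁻ give operators preserving ker
P. Write c(t) = (t - i)/(t + i), so that g = g₋ c⁻ⁿ g₊.

The relation between the factors is a Liouville argument. Since g g̃ = 1 and c c̃ = 1, the function
g₋ g̃₊ ∈ G⁻ is the inverse of g̃₋ g₊, hence also lies in G⁺. Uniqueness of the Fourier data makes it
constant, and its value at 0 is g₊(0) = σ(g), because g₋(0) = 1 and c(0) = -1
(`IsFactorization.minus_eq`).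

The kernel is computed from the Laguerre functions: W⁰(c) shifts ψ_j to ψ_{j+1}, and W⁰(c⁻¹)ψ_0 =
-Jψ_0, so W⁰(c⁻ⁿ)ψ_j = -Jψ_{n-1-j} for j < n. Put e_j = W(g₊⁻¹)ψ_j. As W⁰(g₋)J = σ J W⁰(g₊⁻¹), it
follows that W⁰(g)e_j = -σ J e_{n-1-j} (`W0_apply_plus_inv_psi`). The right side lives on the
negative semi-axis, so e_j ∈ ker W(g) and 𝐏(g)e_j = -σ e_{n-1-j}.

The operator W(g) is onto, so its index is the dimension n of the kernel, and the independent
vectors e_0, …, e_{n-1} form a basis of it. Therefore im 𝐏^±(g) is spanned by the vectors e_j ∓ σ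
e_{n-1-j}. Since σ² = 1, the indices j and n-1-j give proportional vectors; one vector from each
pair remains. For odd n the middle index is its own partner and contributes (1 ∓ σ)e_m, which is
either zero or 2e_m. -/

namespace WienerHopf

/-! ### Convolutions and translations as operators on L^p(ℝ) -/

section Convolution

variable (p : ℝ≥0∞) [Fact (1 ≤ p)]

lemma conv_coe {k : ℝ → ℂ} (hk : Integrable k volume) (f : Lp ℂ p (volume : Measure ℝ)) :
    conv p k hk f =ᵐ[volume] convFun k f :=
  (memLp_convFun Fact.out hk (Lp.memLp f)).coeFn_toLp

lemma translation_coe (δ : ℝ) (f : Lp ℂ p (volume : Measure ℝ)) :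
    translation p δ f =ᵐ[volume] fun t => f (t - δ) :=
  Lp.coeFn_compMeasurePreserving f (measurePreserving_sub_right volume δ)

lemma norm_translation_apply (δ : ℝ) (f : Lp ℂ p (volume : Measure ℝ)) :
    ‖translation p δ f‖ = ‖f‖ :=
  (Lp.compMeasurePreservingₗᵢ ℂ (fun t : ℝ => t - δ)
    (measurePreserving_sub_right volume δ)).norm_map f

lemma norm_translation_le (δ : ℝ) : ‖translation p δ‖ ≤ 1 :=
  ContinuousLinearMap.opNorm_le_bound _ zero_le_one fun f => by
    rw [norm_translation_apply, one_mul]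

lemma conv_congr {k l : ℝ → ℂ} (hk : Integrable k volume) (hl : Integrable l volume)
    (h : k =ᵐ[volume] l) : conv p k hk = conv p l hl := by
  refine ContinuousLinearMap.ext fun f => Lp.ext ?_
  filter_upwards [conv_coe p hk f, conv_coe p hl f] with t h1 h2
  rw [h1, h2, convFun_congr_left h]

lemma norm_conv_le {k : ℝ → ℂ} (hk : Integrable k volume) :
    ‖conv p k hk‖ ≤ (eLpNorm k 1 volume).toReal :=
  ContinuousLinearMap.opNorm_le_bound _ ENNReal.toReal_nonneg (norm_convₗ_le p k hk)

/-- Convolution as a bounded operator from `L¹(ℝ)` to the bounded operators on `L^p(ℝ)`. -/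
noncomputable def convL : Lp ℂ 1 (volume : Measure ℝ) →L[ℂ]
    (Lp ℂ p (volume : Measure ℝ) →L[ℂ] Lp ℂ p (volume : Measure ℝ)) :=
  LinearMap.mkContinuous
    { toFun := fun k => conv p k (L1.integrable_coeFn k)
      map_add' := fun k l => by
        refine ContinuousLinearMap.ext fun f => Lp.ext ?_
        rw [add_apply]
        filter_upwards [conv_coe p (L1.integrable_coeFn (k + l)) f,
          conv_coe p (L1.integrable_coeFn k) f, conv_coe p (L1.integrable_coeFn l) f,
          Lp.coeFn_add (conv p k (L1.integrable_coeFn k) f) (conv p l (L1.integrable_coeFn l) f),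
          ae_integrable_slice (p := p) Fact.out (L1.integrable_coeFn k) (Lp.memLp f),
          ae_integrable_slice (p := p) Fact.out (L1.integrable_coeFn l) (Lp.memLp f)]
          with t h1 h2 h3 h4 h5 h6
        rw [h1, h4, Pi.add_apply, h2, h3, convFun_congr_left (Lp.coeFn_add k l)]
        simp only [convFun, Pi.add_apply, add_mul]
        exact integral_add h5 h6
      map_smul' := fun c k => by
        refine ContinuousLinearMap.ext fun f => Lp.ext ?_
        rw [RingHom.id_apply, smul_apply]
        filter_upwards [conv_coe p (L1.integrable_coeFn (c • k)) f,
          conv_coe p (L1.integrable_coeFn k) f,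
          Lp.coeFn_smul c (conv p k (L1.integrable_coeFn k) f)] with t h1 h2 h3
        rw [h1, h3, Pi.smul_apply, h2, convFun_congr_left (Lp.coeFn_smul c k)]
        simp only [convFun, Pi.smul_apply, smul_eq_mul, mul_assoc]
        exact integral_const_mul c _ }
    1 fun k => by
      rw [one_mul, Lp.norm_def]
      exact norm_conv_le p (L1.integrable_coeFn k)

lemma convL_toL1 {k : ℝ → ℂ} (hk : Integrable k volume) : convL p (hk.toL1 k) = conv p k hk :=
  conv_congr p _ _ hk.coeFn_toL1

lemma convL_coe (k : Lp ℂ 1 (volume : Measure ℝ)) (f : Lp ℂ p (volume : Measure ℝ)) :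
    convL p k f =ᵐ[volume] convFun k f :=
  conv_coe p (L1.integrable_coeFn k) f

lemma ae_sub_right {q : ℝ → Prop} (h : ∀ᵐ t : ℝ, q t) (δ : ℝ) : ∀ᵐ t : ℝ, q (t - δ) :=
  (measurePreserving_sub_right (volume : Measure ℝ) δ).quasiMeasurePreserving.ae h

lemma convL_translation (δ : ℝ) (k : Lp ℂ 1 (volume : Measure ℝ)) :
    convL p (translation 1 δ k) = translation p δ ∘L convL p k := by
  refine ContinuousLinearMap.ext fun f => Lp.ext ?_
  rw [ContinuousLinearMap.comp_apply]
  filter_upwards [convL_coe p (translation 1 δ k) f, translation_coe p δ (convL p k f),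
    ae_sub_right (convL_coe p k f) δ] with t h1 h2 h3
  rw [h1, h2, h3, convFun_congr_left (translation_coe 1 δ k)]
  simp only [convFun, sub_right_comm]

lemma convL_comp_translation (δ : ℝ) (k : Lp ℂ 1 (volume : Measure ℝ)) :
    convL p k ∘L translation p δ = translation p δ ∘L convL p k := by
  refine ContinuousLinearMap.ext fun f => Lp.ext ?_
  rw [ContinuousLinearMap.comp_apply, ContinuousLinearMap.comp_apply]
  filter_upwards [convL_coe p k (translation p δ f), translation_coe p δ (convL p k f),
    ae_sub_right (convL_coe p k f) δ] with t h1 h2 h3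
  rw [h1, h2, h3, convFun_congr (translation_coe p δ f)]
  simp only [convFun]
  rw [← integral_add_right_eq_self _ δ]
  simp only [add_sub_cancel_right, sub_add_eq_sub_sub_swap]

lemma convFun_eq_convolution (k f : ℝ → ℂ) :
    convFun k f = MeasureTheory.convolution f k (ContinuousLinearMap.mul ℂ ℂ) volume := by
  funext t
  simp only [convFun, MeasureTheory.convolution, ContinuousLinearMap.mul_apply', mul_comm]

/-- Fubini, in the form of `convolution_assoc` with the factors in reverse order. Absolute
convergence at almost every t comes from Young's inequality: |k| * |l| is integrable, so its
convolution with |f| ∈ L^p converges almost everywhere. -/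
lemma convFun_assoc {k l f : ℝ → ℂ} (hk : Integrable k volume) (hl : Integrable l volume)
    (hf : MemLp f p volume) :
    convFun k (convFun l f) =ᵐ[volume] convFun (convFun k l) f := by
  have hkn : Integrable (fun s => ((‖k s‖ : ℝ) : ℂ)) volume := hk.norm.ofReal
  have hln : MemLp (fun s => ((‖l s‖ : ℝ) : ℂ)) 1 volume :=
    memLp_one_iff_integrable.2 hl.norm.ofReal
  have hfn : MemLp (fun s => ((‖f s‖ : ℝ) : ℂ)) p volume := hf.norm.ofReal
  -- `convolution_assoc` asks for a real convolution of norms, while the estimates above are for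
  -- complex functions; the two agree because the integrand is nonnegative.
  have hconv : ∀ t, MeasureTheory.convolution (fun x => ‖l x‖) (fun x => ‖k x‖)
      (ContinuousLinearMap.mul ℝ ℝ) volume t =
      ‖convFun (fun s => ((‖k s‖ : ℝ) : ℂ)) (fun s => ((‖l s‖ : ℝ) : ℂ)) t‖ := fun t => by
    simp only [MeasureTheory.convolution, ContinuousLinearMap.mul_apply', convFun, ← ofReal_mul]
    rw [integral_complex_ofReal, norm_real, Real.norm_of_nonneg]
    · simp only [mul_comm]
    · exact integral_nonneg fun s => by positivity
  have hint : Integrable (convFun (fun s => ((‖k s‖ : ℝ) : ℂ)) (fun s => ((‖l s‖ : ℝ) : ℂ)))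
      volume := memLp_one_iff_integrable.1 (memLp_convFun le_rfl hkn hln)
  filter_upwards [ae_integrable_slice (p := p) Fact.out hint hf] with t ht
  simp only [convFun_eq_convolution] at ht ⊢
  refine MeasureTheory.convolution_assoc _ _ _ _ (fun x y z => mul_assoc x y z)
    hf.1 hl.1 hk.1 ?_ ?_ ?_
  · filter_upwards [ae_integrable_slice (p := p) Fact.out hl hf] with y hy
    simpa only [MeasureTheory.ConvolutionExistsAt, ContinuousLinearMap.mul_apply', mul_comm]
      using hy
  · filter_upwards [ae_integrable_slice (p := 1) le_rfl hk (memLp_one_iff_integrable.2 hl)]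
      with y hy
    simpa only [MeasureTheory.ConvolutionExistsAt, ContinuousLinearMap.mul_apply', norm_mul,
      mul_comm] using hy.norm
  · simp only [MeasureTheory.ConvolutionExistsAt, ContinuousLinearMap.mul_apply', hconv]
    simpa only [norm_mul, convFun_eq_convolution, mul_comm] using ht.norm

/-- The product of L¹(ℝ) is the same construction at exponent 1, so associativity of convolution
becomes multiplicativity of `convL p`. -/
lemma convL_convL (k l : Lp ℂ 1 (volume : Measure ℝ)) :
    convL p (convL 1 k l) = convL p k ∘L convL p l := by
  refine ContinuousLinearMap.ext fun f => Lp.ext ?_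
  rw [ContinuousLinearMap.comp_apply]
  filter_upwards [convL_coe p (convL 1 k l) f, convL_coe p k (convL p l f),
    convFun_assoc p (L1.integrable_coeFn k) (L1.integrable_coeFn l) (Lp.memLp f)] with t h1 h2 h3
  rw [h1, h2, convFun_congr_left (convL_coe 1 k l), convFun_congr (convL_coe p l f), h3]

end Convolution

/-! ### Multiplicativity of the operators on the level of representations -/

section Multiplicativity

variable (p : ℝ≥0∞) [Fact (1 ≤ p)]

/-- The operator `∑_δ a_δ f(· - δ)` on `L^p(ℝ)`. -/
noncomputable def discOp (a : ℝ → ℂ) :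
    Lp ℂ p (volume : Measure ℝ) →L[ℂ] Lp ℂ p (volume : Measure ℝ) :=
  ∑' δ : ℝ, a δ • translation p δ

/-- The kernel as an element of `L¹(ℝ)`. -/
noncomputable def Rep.kernelL1 (r : Rep) : Lp ℂ 1 (volume : Measure ℝ) :=
  r.integrable_kernel.toL1 r.kernel

lemma Rep.op_eq (r : Rep) : r.op p = discOp p r.coeff + convL p r.kernelL1 := by
  rw [Rep.kernelL1, convL_toL1]
  rfl

lemma norm_smul_translation_le (a : ℝ → ℂ) (δ : ℝ) : ‖a δ • translation p δ‖ ≤ ‖a δ‖ := by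
  rw [norm_smul]
  exact mul_le_of_le_one_right (norm_nonneg _) (norm_translation_le p δ)

lemma summable_norm_smul_translation {a : ℝ → ℂ} (ha : Summable fun δ => ‖a δ‖) :
    Summable fun δ => ‖a δ • translation p δ‖ :=
  Summable.of_nonneg_of_le (fun _ => norm_nonneg _) (norm_smul_translation_le p a) ha

lemma summable_smul_translation {a : ℝ → ℂ} (ha : Summable fun δ => ‖a δ‖) :
    Summable fun δ => a δ • translation p δ :=
  (summable_norm_smul_translation p ha).of_norm

lemma discOp_apply {a : ℝ → ℂ} (ha : Summable fun δ => ‖a δ‖)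
    (f : Lp ℂ p (volume : Measure ℝ)) :
    HasSum (fun δ => a δ • translation p δ f) (discOp p a f) := by
  have h := (ContinuousLinearMap.apply ℂ (Lp ℂ p (volume : Measure ℝ)) f).hasSum
    (summable_smul_translation p ha).hasSum
  simp only [ContinuousLinearMap.apply_apply, smul_apply] at h
  unfold discOp
  exact h

lemma translation_mul (δ ε : ℝ) : translation p δ * translation p ε = translation p (δ + ε) := by
  refine ContinuousLinearMap.ext fun f => Lp.ext ?_
  rw [mul_apply_eq_comp]
  filter_upwards [translation_coe p δ (translation p ε f),
    ae_sub_right (translation_coe p ε f) δ, translation_coe p (δ + ε) f] with t h1 h2 h3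
  rw [h1, h2, h3, sub_add_eq_sub_sub]

/-- Convolution of families on the discrete group `ℝ`. -/
noncomputable def discConv (a b : ℝ → ℂ) (γ : ℝ) : ℂ := ∑' δ : ℝ, a δ * b (γ - δ)

/-- The shear `(γ, δ) ↦ (δ, γ - δ)`. -/
def shearEquiv : ℝ × ℝ ≃ ℝ × ℝ where
  toFun x := (x.2, x.1 - x.2)
  invFun x := (x.1 + x.2, x.1)
  left_inv x := by simp
  right_inv x := by simp

lemma summable_discConv_aux {a b : ℝ → ℂ} (ha : Summable fun δ => ‖a δ‖)
    (hb : Summable fun δ => ‖b δ‖) :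
    Summable fun x : ℝ × ℝ => ‖a x.2 * b (x.1 - x.2)‖ := by
  have h := ha.mul_of_nonneg hb (fun _ => norm_nonneg _) (fun _ => norm_nonneg _)
  simpa only [norm_mul] using! shearEquiv.summable_iff.2 h

lemma summable_discConv {a b : ℝ → ℂ} (ha : Summable fun δ => ‖a δ‖)
    (hb : Summable fun δ => ‖b δ‖) : Summable fun γ => ‖discConv a b γ‖ := by
  have h := summable_discConv_aux ha hb
  exact Summable.of_nonneg_of_le (fun _ => norm_nonneg _)
    (fun γ => norm_tsum_le_tsum_norm (h.prod_factor γ)) h.prod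

/-- A Cauchy product of absolutely convergent series in a Banach algebra; the shear makes the total
frequency the outer summation variable. -/
lemma discOp_discConv {a b : ℝ → ℂ} (ha : Summable fun δ => ‖a δ‖)
    (hb : Summable fun δ => ‖b δ‖) : discOp p (discConv a b) = discOp p a * discOp p b := by
  have h := summable_discConv_aux ha hb
  have h' : Summable fun x : ℝ × ℝ => (a x.2 * b (x.1 - x.2)) • translation p x.1 := by
    refine Summable.of_norm_bounded h fun x => ?_
    rw [norm_smul]
    exact mul_le_of_le_one_right (norm_nonneg _) (norm_translation_le p _)
  unfold discOp
  rw [tsum_mul_tsum_of_summable_norm (summable_norm_smul_translation p ha)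
    (summable_norm_smul_translation p hb), ← shearEquiv.tsum_eq]
  have e : ∀ x : ℝ × ℝ, a (shearEquiv x).1 • translation p (shearEquiv x).1 *
      b (shearEquiv x).2 • translation p (shearEquiv x).2 =
      (a x.2 * b (x.1 - x.2)) • translation p x.1 := fun x => by
    rw [smul_mul_smul_comm, translation_mul]
    simp [shearEquiv]
  simp only [e]
  rw [h'.tsum_prod]
  refine tsum_congr fun γ => ?_
  exact ((h.prod_factor γ).of_norm.tsum_smul_const (translation p γ)).symm

lemma convL_mul_discOp {a : ℝ → ℂ} (ha : Summable fun δ => ‖a δ‖)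
    (k : Lp ℂ 1 (volume : Measure ℝ)) :
    convL p k * discOp p a = discOp p a * convL p k := by
  have hs := summable_smul_translation p ha
  rw [discOp, ← hs.tsum_mul_left, ← hs.tsum_mul_right]
  refine tsum_congr fun δ => ?_
  rw [mul_smul_comm, smul_mul_assoc]
  exact congrArg _ (convL_comp_translation p δ k)

/-- Boundedness of `convL p` as a map out of L¹ lets the series of translations pass through it term
by term. -/
lemma convL_discOp {a : ℝ → ℂ} (ha : Summable fun δ => ‖a δ‖)
    (k : Lp ℂ 1 (volume : Measure ℝ)) :
    convL p (discOp 1 a k) = discOp p a * convL p k := by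
  have h := (convL p).hasSum (discOp_apply 1 ha k)
  rw [← h.tsum_eq, discOp, ← (summable_smul_translation p ha).tsum_mul_right]
  refine tsum_congr fun δ => ?_
  rw [map_smul, smul_mul_assoc, convL_translation]
  rfl

/-- The representation of a product. -/
noncomputable def Rep.mul (r s : Rep) : Rep where
  coeff := discConv r.coeff s.coeff
  summable_coeff := summable_discConv r.summable_coeff s.summable_coeff
  -- Write the factors as A + K and B + L, with A, B discrete and K, L convolutions. The discrete
  -- part of the product is AB; the kernel collects AL + KL and BK, where BK stands for KB.
  kernel := (r.op 1 s.kernelL1 + discOp 1 s.coeff r.kernelL1 : Lp ℂ 1 (volume : Measure ℝ))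
  integrable_kernel := L1.integrable_coeFn _

lemma Rep.kernelL1_mul (r s : Rep) :
    (r.mul s).kernelL1 = r.op 1 s.kernelL1 + discOp 1 s.coeff r.kernelL1 :=
  Integrable.toL1_coeFn _ _

lemma Rep.op_mul (r s : Rep) : (r.mul s).op p = r.op p * s.op p := by
  rw [Rep.op_eq, Rep.kernelL1_mul, map_add, Rep.op_eq, Rep.op_eq, Rep.op_eq, add_apply, map_add,
    convL_discOp p r.summable_coeff, convL_discOp p s.summable_coeff, convL_convL,
    ← convL_mul_discOp p s.summable_coeff]
  simp only [Rep.mul]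
  rw [discOp_discConv p r.summable_coeff s.summable_coeff, add_mul, mul_add, mul_add]
  simp only [ContinuousLinearMap.mul_def]
  abel

end Multiplicativity

/-! ### Characters as common eigenvectors -/

section Characters

lemma memLp_character (t : ℝ) : MemLp (fun x : ℝ => cexp (-(I * t * x))) ∞ volume := by
  refine memLp_top_of_bound (Continuous.aestronglyMeasurable (by fun_prop)) 1
    (Filter.Eventually.of_forall fun x => ?_)
  rw [show -(I * (t : ℂ) * x) = ((-(t * x) : ℝ) : ℂ) * I by push_cast; ring,
    norm_exp_ofReal_mul_I]

/-- The character `x ↦ e^{-itx}` as an element of `L^∞(ℝ)`. -/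
noncomputable def character (t : ℝ) : Lp ℂ ∞ (volume : Measure ℝ) := (memLp_character t).toLp _

lemma character_coe (t : ℝ) : character t =ᵐ[volume] fun x : ℝ => cexp (-(I * t * x)) :=
  (memLp_character t).coeFn_toLp

lemma character_ne_zero (t : ℝ) : character t ≠ 0 := fun h => by
  have h1 := character_coe t
  rw [h] at h1
  have h2 : ∀ᵐ _ : ℝ, False := by
    filter_upwards [h1, Lp.coeFn_zero ℂ ∞ (volume : Measure ℝ)] with x h3 h4
    rw [h4] at h3
    exact exp_ne_zero _ h3.symm
  exact (NeZero.ne (volume : Measure ℝ)) (by simpa using h2)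

lemma translation_character (δ t : ℝ) :
    translation ∞ δ (character t) = cexp (I * δ * t) • character t := by
  refine Lp.ext ?_
  filter_upwards [translation_coe ∞ δ (character t), ae_sub_right (character_coe t) δ,
    Lp.coeFn_smul (cexp (I * δ * t)) (character t), character_coe t] with x h1 h2 h3 h4
  rw [h1, h2, h3, Pi.smul_apply, h4, smul_eq_mul, ← exp_add]
  congr 1
  push_cast
  ring

lemma convFun_character (k : ℝ → ℂ) (t x : ℝ) :
    convFun k (fun x : ℝ => cexp (-(I * t * x))) x =
      (∫ s : ℝ, k s * cexp (I * t * s)) * cexp (-(I * t * x)) := by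
  rw [convFun, ← integral_sub_left_eq_self _ volume x, ← integral_mul_const]
  refine integral_congr_ae (Filter.Eventually.of_forall fun s => ?_)
  simp only [sub_sub_cancel]
  rw [mul_assoc (k s), ← exp_add]
  congr 2
  push_cast
  ring

lemma Rep.op_character (r : Rep) (t : ℝ) :
    r.op ∞ (character t) = r.symbol t • character t := by
  rw [Rep.op_eq, add_apply, Rep.symbol, add_smul]
  congr 1
  · rw [← (discOp_apply ∞ r.summable_coeff (character t)).tsum_eq]
    have hs : Summable fun δ : ℝ => r.coeff δ * cexp (I * δ * t) := by
      refine Summable.of_norm_bounded r.summable_coeff fun δ => ?_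
      rw [norm_mul, show I * (δ : ℂ) * t = ((δ * t : ℝ) : ℂ) * I by push_cast; ring,
        norm_exp_ofReal_mul_I, mul_one]
    rw [← hs.tsum_smul_const]
    refine tsum_congr fun δ => ?_
    rw [translation_character, smul_smul]
  · refine Lp.ext ?_
    filter_upwards [convL_coe ∞ r.kernelL1 (character t), character_coe t,
      Lp.coeFn_smul (∫ s : ℝ, r.kernel s * cexp (I * t * s)) (character t)] with x h1 h2 h3
    rw [h1, h3, Pi.smul_apply, h2, convFun_congr (character_coe t),
      convFun_congr_left (k := r.kernelL1) r.integrable_kernel.coeFn_toL1, convFun_character, smul_eq_mul]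

/-- The operator identity `Rep.op_mul` at p = ∞ is applied to the character e^{-itx}, a nonzero
common eigenvector whose eigenvalue is the symbol at t. No separate computation with Fourier
integrals is required. -/
lemma Rep.symbol_mul (r s : Rep) : (r.mul s).symbol = r.symbol * s.symbol := by
  funext t
  have h := (r.mul s).op_character t
  rw [Rep.op_mul, mul_apply_eq_comp, Rep.op_character, map_smul, Rep.op_character, smul_smul] at h
  rw [← smul_left_injective ℂ (character_ne_zero t) h, Pi.mul_apply, mul_comm]

end Characters

/-! ### The homomorphism W⁰, constants and reflection -/

section Algebra

variable (p : ℝ≥0∞) [Fact (1 ≤ p)]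

lemma mul_mem_G {a b : ℝ → ℂ} (ha : a ∈ G) (hb : b ∈ G) : a * b ∈ G := by
  obtain ⟨r, rfl⟩ := ha
  obtain ⟨s, rfl⟩ := hb
  exact ⟨r.mul s, r.symbol_mul s⟩

lemma W0_mul {a b : ℝ → ℂ} (ha : a ∈ G) (hb : b ∈ G) : W0 p (a * b) = W0 p a * W0 p b := by
  obtain ⟨r, rfl⟩ := ha
  obtain ⟨s, rfl⟩ := hb
  rw [← Rep.symbol_mul, W0_symbol, W0_symbol, W0_symbol, Rep.op_mul]

/-- The representation of a constant function. -/
noncomputable def Rep.const (c : ℂ) : Rep where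
  coeff := Pi.single 0 c
  summable_coeff := summable_of_ne_finset_zero (s := {0}) fun δ hδ => by
    rw [Pi.single_eq_of_ne (by simpa using hδ), norm_zero]
  kernel := 0
  integrable_kernel := integrable_zero _ _ _

lemma Rep.symbol_const (c : ℂ) : (Rep.const c).symbol = fun _ => c := by
  funext t
  simp only [Rep.symbol, Rep.const]
  rw [tsum_eq_single 0 fun δ hδ => by rw [Pi.single_eq_of_ne hδ, zero_mul]]
  simp

lemma discOp_single (c : ℂ) (f : Lp ℂ p (volume : Measure ℝ)) :
    discOp p (Pi.single 0 c) f = c • f := by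
  rw [discOp, tsum_eq_single 0 fun δ hδ => by rw [Pi.single_eq_of_ne hδ, zero_smul],
    Pi.single_eq_same, smul_apply]
  congr 1
  refine Lp.ext ?_
  filter_upwards [translation_coe p 0 f] with t h
  rw [h, sub_zero]

lemma W0_const (c : ℂ) (f : Lp ℂ p (volume : Measure ℝ)) : W0 p (fun _ => c) f = c • f := by
  have hk : (Rep.const c).kernelL1 = 0 := Integrable.toL1_zero _
  rw [← Rep.symbol_const, W0_symbol, Rep.op_eq, hk, map_zero, add_zero]
  exact discOp_single p c f

/-- The representation of `t ↦ a(-t)`. -/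
noncomputable def Rep.reflect (r : Rep) : Rep where
  coeff δ := r.coeff (-δ)
  summable_coeff := (Equiv.neg ℝ).summable_iff.2 r.summable_coeff
  kernel s := r.kernel (-s)
  integrable_kernel := r.integrable_kernel.comp_neg

lemma Rep.symbol_reflect (r : Rep) : r.reflect.symbol = fun t => r.symbol (-t) := by
  funext t
  simp only [Rep.symbol, Rep.reflect]
  rw [← (Equiv.neg ℝ).tsum_eq, ← integral_neg_eq_self]
  simp

lemma ae_neg {q : ℝ → Prop} (h : ∀ᵐ t : ℝ, q t) : ∀ᵐ t : ℝ, q (-t) :=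
  (Measure.measurePreserving_neg (volume : Measure ℝ)).quasiMeasurePreserving.ae h

lemma reflection_reflection (f : Lp ℂ p (volume : Measure ℝ)) :
    reflection p (reflection p f) = f := by
  refine Lp.ext ?_
  filter_upwards [reflection_coe p (reflection p f), ae_neg (reflection_coe p f)] with t h1 h2
  rw [h1, h2, neg_neg]

lemma reflection_translation (δ : ℝ) (f : Lp ℂ p (volume : Measure ℝ)) :
    reflection p (translation p δ f) = translation p (-δ) (reflection p f) := by
  refine Lp.ext ?_
  filter_upwards [reflection_coe p (translation p δ f), ae_neg (translation_coe p δ f),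
    translation_coe p (-δ) (reflection p f), ae_sub_right (reflection_coe p f) (-δ)]
    with t h1 h2 h3 h4
  rw [h1, h2, h3, h4]
  congr 1
  ring

lemma reflection_conv {k : ℝ → ℂ} (hk : Integrable k volume) (f : Lp ℂ p (volume : Measure ℝ)) :
    reflection p (conv p k hk f) = conv p (fun s => k (-s)) hk.comp_neg (reflection p f) := by
  refine Lp.ext ?_
  filter_upwards [reflection_coe p (conv p k hk f), ae_neg (conv_coe p hk f),
    conv_coe p hk.comp_neg (reflection p f)] with t h1 h2 h3
  rw [h1, h2, h3, convFun_congr (reflection_coe p f), convFun, convFun, ← integral_neg_eq_self]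
  refine integral_congr_ae (Filter.Eventually.of_forall fun s => ?_)
  simp only
  congr 2
  ring

lemma reflection_op (r : Rep) (f : Lp ℂ p (volume : Measure ℝ)) :
    reflection p (r.op p f) = r.reflect.op p (reflection p f) := by
  rw [Rep.op_eq, Rep.op_eq, add_apply, add_apply, map_add, Rep.kernelL1, convL_toL1,
    Rep.kernelL1, convL_toL1, reflection_conv]
  congr 1
  have h := (reflection p).hasSum (discOp_apply p r.summable_coeff f)
  have h' := discOp_apply p r.reflect.summable_coeff (reflection p f)
  rw [← h.tsum_eq, ← h'.tsum_eq, ← (Equiv.neg ℝ).tsum_eq]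
  refine tsum_congr fun δ => ?_
  rw [map_smul, reflection_translation]
  simp [Rep.reflect]

lemma reflection_W0 {a : ℝ → ℂ} (ha : a ∈ G) (f : Lp ℂ p (volume : Measure ℝ)) :
    reflection p (W0 p a f) = W0 p (fun t => a (-t)) (reflection p f) := by
  obtain ⟨r, rfl⟩ := ha
  rw [← Rep.symbol_reflect, W0_symbol, W0_symbol, reflection_op]

end Algebra

/-! ### Supports: G⁺ preserves L^p(ℝ⁺), G⁻ preserves ker P -/

section Support

variable (p : ℝ≥0∞) [Fact (1 ≤ p)]

lemma ae_ne_zero : ∀ᵐ t : ℝ, t ≠ 0 := by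
  simp [ae_iff]

omit [Fact (1 ≤ p)] in
lemma mem_LpPlus_iff {f : Lp ℂ p (volume : Measure ℝ)} :
    f ∈ LpPlus p ↔ ∀ᵐ t : ℝ, t < 0 → f t = 0 := Iff.rfl

lemma mem_LpPlus_iff_projP {f : Lp ℂ p (volume : Measure ℝ)} :
    f ∈ LpPlus p ↔ projP p f = f := by
  refine ⟨fun hf => Lp.ext ?_, fun hf => hf ▸ projP_mem p f⟩
  filter_upwards [projP_coe p f, hf, ae_ne_zero] with t h1 h2 h3
  rw [h1]
  by_cases ht : 0 < t
  · exact Set.indicator_of_mem (by exact ht) _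
  · rw [Set.indicator_of_notMem (by exact ht), h2 (lt_of_le_of_ne (not_lt.1 ht) h3)]

lemma isClosed_LpPlus : IsClosed (LpPlus p : Set (Lp ℂ p (volume : Measure ℝ))) := by
  have : (LpPlus p : Set (Lp ℂ p (volume : Measure ℝ))) = {f | projP p f = f} :=
    Set.ext fun f => mem_LpPlus_iff_projP p
  rw [this]
  exact isClosed_eq (projP p).continuous continuous_id

/-- Expresses vanishing on the positive semi-axis through `LpPlus`, so that facts about G⁻ follow
from those about G⁺ by reflection. -/
lemma projP_eq_zero_iff {f : Lp ℂ p (volume : Measure ℝ)} :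
    projP p f = 0 ↔ reflection p f ∈ LpPlus p := by
  constructor
  · intro h
    have : projQ p f = f := by
      rw [projQ, sub_apply, h, sub_zero]
      rfl
    exact this ▸ reflection_projQ_mem p f
  · intro h
    refine Lp.ext ?_
    filter_upwards [projP_coe p f, ae_neg h, ae_neg (reflection_coe p f),
      Lp.coeFn_zero ℂ p (volume : Measure ℝ)] with t h1 h2 h3 h4
    rw [h1, h4]
    refine Set.indicator_apply_eq_zero.2 fun ht => ?_
    rw [neg_neg] at h3
    rw [← h3, h2 (by simpa using ht)]

lemma projQ_apply (f : Lp ℂ p (volume : Measure ℝ)) : projQ p f = f - projP p f := rfl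

/-- Frequencies in `[0, ∞)`, kernel supported on the positive semi-axis. -/
def Rep.IsPlus (r : Rep) : Prop :=
  (∀ δ < 0, r.coeff δ = 0) ∧ ∀ᵐ s : ℝ, s < 0 → r.kernel s = 0

lemma translation_mem_LpPlus {δ : ℝ} (hδ : 0 ≤ δ) {f : Lp ℂ p (volume : Measure ℝ)}
    (hf : f ∈ LpPlus p) : translation p δ f ∈ LpPlus p := by
  rw [mem_LpPlus_iff] at hf ⊢
  filter_upwards [translation_coe p δ f, ae_sub_right hf δ] with t h1 h2 ht
  rw [h1, h2 (by linarith)]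

lemma discOp_mem_LpPlus {a : ℝ → ℂ} (ha : Summable fun δ => ‖a δ‖) (ha0 : ∀ δ < 0, a δ = 0)
    {f : Lp ℂ p (volume : Measure ℝ)} (hf : f ∈ LpPlus p) : discOp p a f ∈ LpPlus p := by
  rw [← (discOp_apply p ha f).tsum_eq]
  refine (isClosed_LpPlus p).mem_of_tendsto (discOp_apply p ha f).summable.hasSum
    (Filter.Eventually.of_forall fun s => Submodule.sum_mem _ fun δ _ => ?_)
  rcases lt_or_ge δ 0 with h | h
  · rw [ha0 δ h, zero_smul]
    exact Submodule.zero_mem _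
  · exact Submodule.smul_mem _ _ (translation_mem_LpPlus p h hf)

lemma convFun_eq_zero_of_neg {k f : ℝ → ℂ} (hk : ∀ᵐ s : ℝ, s < 0 → k s = 0)
    (hf : ∀ᵐ s : ℝ, s < 0 → f s = 0) {t : ℝ} (ht : t < 0) : convFun k f t = 0 := by
  refine integral_eq_zero_of_ae ?_
  filter_upwards [hf, (Measure.measurePreserving_sub_left (volume : Measure ℝ)
    t).quasiMeasurePreserving.ae hk] with s h1 h2
  rcases lt_or_ge s 0 with h | h
  · rw [h1 h, mul_zero, Pi.zero_apply]
  · rw [h2 (by linarith), zero_mul, Pi.zero_apply]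

lemma Rep.IsPlus.op_mem {r : Rep} (hr : r.IsPlus) {f : Lp ℂ p (volume : Measure ℝ)}
    (hf : f ∈ LpPlus p) : r.op p f ∈ LpPlus p := by
  rw [Rep.op_eq, add_apply]
  refine Submodule.add_mem _ (discOp_mem_LpPlus p r.summable_coeff hr.1 hf) ?_
  rw [Rep.kernelL1, convL_toL1, mem_LpPlus_iff]
  filter_upwards [conv_coe p r.integrable_kernel f] with t h1 ht
  rw [h1, convFun_eq_zero_of_neg hr.2 hf ht]

lemma Rep.IsPlus.kernelL1_mem {r : Rep} (hr : r.IsPlus) : r.kernelL1 ∈ LpPlus 1 := by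
  rw [mem_LpPlus_iff]
  filter_upwards [r.integrable_kernel.coeFn_toL1, hr.2] with t h1 h2 ht
  rw [Rep.kernelL1, h1, h2 ht]

lemma Rep.IsPlus.mul {r s : Rep} (hr : r.IsPlus) (hs : s.IsPlus) : (r.mul s).IsPlus := by
  refine ⟨fun γ hγ => ?_, ?_⟩
  · refine (tsum_congr fun δ => ?_).trans tsum_zero
    rcases lt_or_ge δ 0 with h | h
    · rw [hr.1 δ h, zero_mul]
    · rw [hs.1 _ (by linarith), mul_zero]
  · exact Submodule.add_mem (LpPlus 1) (hr.op_mem 1 hs.kernelL1_mem)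
      (discOp_mem_LpPlus 1 s.summable_coeff hs.1 hr.kernelL1_mem)

lemma GPlus_subset_G : GPlus ⊆ G := Set.image_subset_range _ _

lemma GMinus_subset_G : GMinus ⊆ G := Set.image_subset_range _ _

lemma mul_mem_GPlus {a b : ℝ → ℂ} (ha : a ∈ GPlus) (hb : b ∈ GPlus) : a * b ∈ GPlus := by
  obtain ⟨r, hr, rfl⟩ := ha
  obtain ⟨s, hs, rfl⟩ := hb
  exact ⟨r.mul s, Rep.IsPlus.mul hr hs, r.symbol_mul s⟩

lemma const_mem_GPlus (c : ℂ) : (fun _ => c) ∈ GPlus :=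
  ⟨Rep.const c, ⟨fun _ h => Pi.single_eq_of_ne h.ne _, Filter.Eventually.of_forall fun _ _ => rfl⟩,
    Rep.symbol_const c⟩

lemma reflect_mem_GMinus {a : ℝ → ℂ} (ha : a ∈ GPlus) : (fun t => a (-t)) ∈ GMinus := by
  obtain ⟨r, hr, rfl⟩ := ha
  refine ⟨r.reflect, ⟨fun δ hδ => hr.1 _ (by simpa using hδ), ?_⟩, r.symbol_reflect⟩
  filter_upwards [ae_neg hr.2] with s h hs
  exact h (by simpa using hs)

lemma reflect_mem_GPlus {a : ℝ → ℂ} (ha : a ∈ GMinus) : (fun t => a (-t)) ∈ GPlus := by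
  obtain ⟨r, hr, rfl⟩ := ha
  refine ⟨r.reflect, ⟨fun δ hδ => hr.1 _ (by simpa using hδ), ?_⟩, r.symbol_reflect⟩
  filter_upwards [ae_neg hr.2] with s h hs
  exact h (by simpa using hs)

lemma mul_mem_GMinus {a b : ℝ → ℂ} (ha : a ∈ GMinus) (hb : b ∈ GMinus) : a * b ∈ GMinus := by
  have h := reflect_mem_GMinus (mul_mem_GPlus (reflect_mem_GPlus ha) (reflect_mem_GPlus hb))
  simpa only [Pi.mul_apply, neg_neg] using! h

lemma W0_mem_LpPlus {a : ℝ → ℂ} (ha : a ∈ GPlus) {f : Lp ℂ p (volume : Measure ℝ)}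
    (hf : f ∈ LpPlus p) : W0 p a f ∈ LpPlus p := by
  obtain ⟨r, hr, rfl⟩ := ha
  rw [W0_symbol]
  exact Rep.IsPlus.op_mem p hr hf

lemma projP_W0_eq_zero {a : ℝ → ℂ} (ha : a ∈ GMinus) {f : Lp ℂ p (volume : Measure ℝ)}
    (hf : projP p f = 0) : projP p (W0 p a f) = 0 := by
  rw [projP_eq_zero_iff] at hf ⊢
  rw [reflection_W0 p (GMinus_subset_G ha)]
  exact W0_mem_LpPlus p (reflect_mem_GPlus ha) hf

/-- The Liouville theorem of this setting. By `Rep.unique` the two representations share their data,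
which then live on both closed semi-axes; only the frequency 0 survives, the point 0 being null for
the kernel. -/
lemma eq_const_of_mem_GPlus_of_mem_GMinus {a : ℝ → ℂ} (ha : a ∈ GPlus) (ha' : a ∈ GMinus)
    (t : ℝ) : a t = a 0 := by
  obtain ⟨r, hr, rfl⟩ := ha
  obtain ⟨s, hs, h⟩ := ha'
  obtain ⟨hc, hk⟩ := Rep.unique h
  have hc0 : ∀ δ ≠ 0, r.coeff δ = 0 := fun δ hδ => by
    rcases lt_or_gt_of_ne hδ with h | h
    · exact hr.1 δ h
    · rw [← hc]
      exact hs.1 δ h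
  have hk0 : r.kernel =ᵐ[volume] 0 := by
    filter_upwards [hk, hr.2, hs.2, ae_ne_zero] with x h1 h2 h3 h4
    rcases lt_or_gt_of_ne h4 with h | h
    · exact h2 h
    · rw [← h1]
      exact h3 h
  have key : ∀ t, r.symbol t = r.coeff 0 := fun t => by
    rw [Rep.symbol, tsum_eq_single 0 fun δ hδ => by rw [hc0 δ hδ, zero_mul],
      integral_eq_zero_of_ae]
    · simp
    · filter_upwards [hk0] with x hx
      rw [hx, Pi.zero_apply, zero_mul]
  rw [key, key]

end Support

/-! ### The symbol (t - i)/(t + i) and its action on the Laguerre functions -/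

/-- The function `t ↦ (t - i)/(t + i)`. -/
noncomputable def cayley (t : ℝ) : ℂ := (t - I) / (t + I)

/-- The kernel `-2 e^{-s}` on `(0, ∞)`. -/
noncomputable def cayleyKernel : ℝ → ℂ :=
  (Set.Ioi (0 : ℝ)).indicator fun s => ((-2 * Real.exp (-s) : ℝ) : ℂ)

lemma integrable_cayleyKernel : Integrable cayleyKernel volume := by
  refine (integrable_indicator_iff measurableSet_Ioi).2 (Integrable.ofReal ?_)
  exact (integrableOn_exp_neg_Ioi 0).const_mul (-2)

/-- The representation of `(t - i)/(t + i)`. -/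
noncomputable def cayleyRep : Rep where
  coeff := Pi.single 0 1
  summable_coeff := (Rep.const 1).summable_coeff
  kernel := cayleyKernel
  integrable_kernel := integrable_cayleyKernel

lemma cayleyKernel_of_neg {s : ℝ} (hs : s < 0) : cayleyKernel s = 0 :=
  Set.indicator_of_notMem (by simpa using hs.le) _

lemma psiFun_of_neg (j : ℕ) {s : ℝ} (hs : s < 0) : psiFun j s = 0 :=
  Set.indicator_of_notMem (by simpa using hs.le) _

lemma add_I_ne_zero (t : ℝ) : (t : ℂ) + I ≠ 0 := fun h => by
  simpa using congrArg Complex.im h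

lemma sub_I_ne_zero (t : ℝ) : (t : ℂ) - I ≠ 0 := fun h => by
  simpa using congrArg Complex.im h

lemma cayley_ne_zero (t : ℝ) : cayley t ≠ 0 := div_ne_zero (sub_I_ne_zero t) (add_I_ne_zero t)

lemma cayley_neg (t : ℝ) : cayley (-t) = (cayley t)⁻¹ := by
  have h1 := add_I_ne_zero t
  have h2 := sub_I_ne_zero t
  have h3 : -(t : ℂ) + I ≠ 0 := fun h => h2 (by linear_combination -h)
  simp only [cayley, ofReal_neg, inv_div]
  rw [div_eq_div_iff h3 h2]
  ring

/-- The elementary identity (t - i)/(t + i) = 1 + 2/(it - 1), the fraction being the Fourier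
integral of -2e^{-s} over (0, ∞). -/
lemma symbol_cayleyRep : cayleyRep.symbol = cayley := by
  funext t
  have h0 : I * (t : ℂ) - 1 ≠ 0 := fun h => by simpa using congrArg Complex.re h
  have h1 : ∫ s : ℝ, cayleyKernel s * cexp (I * t * s) = 2 / (I * t - 1) := by
    have e : (fun s : ℝ => cayleyKernel s * cexp (I * t * s)) =
        (Set.Ioi (0 : ℝ)).indicator fun s : ℝ => -2 * cexp ((I * t - 1) * s) := by
      funext s
      by_cases hs : s ∈ Set.Ioi (0 : ℝ)
      · rw [cayleyKernel, Set.indicator_of_mem hs, Set.indicator_of_mem hs]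
        push_cast
        rw [mul_assoc, ← exp_add]
        congr 2
        ring
      · rw [cayleyKernel, Set.indicator_of_notMem hs, Set.indicator_of_notMem hs, zero_mul]
    rw [e, integral_indicator measurableSet_Ioi, integral_const_mul,
      integral_exp_mul_complex_Ioi (by simp)]
    simp
    ring
  simp only [Rep.symbol, cayleyRep]
  rw [tsum_eq_single 0 fun δ hδ => by rw [Pi.single_eq_of_ne hδ, zero_mul]]
  simp only [Pi.single_eq_same, ofReal_zero, mul_zero, zero_mul, exp_zero, mul_one]
  rw [h1, cayley, eq_div_iff (add_I_ne_zero t)]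
  field_simp
  linear_combination (2 * t : ℂ) * I_sq

lemma cayley_mem_GPlus : cayley ∈ GPlus := by
  refine ⟨cayleyRep, ⟨fun _ h => Pi.single_eq_of_ne h.ne _, ?_⟩, symbol_cayleyRep⟩
  exact Filter.Eventually.of_forall fun s hs => cayleyKernel_of_neg hs

lemma cayley_inv_mem_GMinus : cayley⁻¹ ∈ GMinus := by
  have h := reflect_mem_GMinus cayley_mem_GPlus
  simp only [cayley_neg] at h
  exact h

section Laguerre

/-- The antiderivative of `Λ_j` vanishing at `0`. -/
noncomputable def laguerrePrimitive (j : ℕ) (x : ℝ) : ℝ :=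
  ∑ i ∈ Finset.range (j + 1),
    (j.choose i : ℝ) * (-1) ^ i / ((i + 1).factorial : ℝ) * x ^ (i + 1)

lemma hasDerivAt_laguerrePrimitive (j : ℕ) (x : ℝ) :
    HasDerivAt (laguerrePrimitive j) (laguerre j x) x := by
  unfold laguerrePrimitive laguerre
  refine HasDerivAt.fun_sum fun i _ => ?_
  have h := (hasDerivAt_pow (i + 1) x).const_mul
    ((j.choose i : ℝ) * (-1) ^ i / ((i + 1).factorial : ℝ))
  refine h.congr_deriv ?_
  rw [Nat.factorial_succ]
  have : (i.factorial : ℝ) ≠ 0 := by positivity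
  have : (i : ℝ) + 1 ≠ 0 := by positivity
  rw [add_tsub_cancel_right]
  push_cast
  field_simp

lemma continuous_laguerre (j : ℕ) : Continuous (laguerre j) := by
  unfold laguerre
  fun_prop

/-- Pascal's rule on the coefficients: one of the two binomials reproduces Λ_j, the other, shifted
by one degree, gives minus its primitive. -/
lemma laguerre_succ (j : ℕ) (x : ℝ) :
    laguerre (j + 1) x = laguerre j x - laguerrePrimitive j x := by
  -- A zero term is appended, since `j.choose (j + 1) = 0`, to match the number of terms of Λ_{j+1}.
  have h : laguerre j x = ∑ i ∈ Finset.range (j + 1 + 1),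
      (j.choose i : ℝ) * (-1) ^ i / (i.factorial : ℝ) * x ^ i := by
    rw [Finset.sum_range_succ, Nat.choose_succ_self]
    simp [laguerre]
  rw [h, laguerre, laguerrePrimitive, Finset.sum_range_succ' _ (j + 1),
    Finset.sum_range_succ' _ (j + 1),
    add_sub_right_comm, ← Finset.sum_sub_distrib]
  congr 1
  · refine Finset.sum_congr rfl fun i _ => ?_
    rw [Nat.choose_succ_succ']
    push_cast
    ring
  · simp

lemma integral_laguerre (j : ℕ) (t : ℝ) :
    ∫ s in (0 : ℝ)..t, 2 * laguerre j (2 * s) = laguerre j (2 * t) - laguerre (j + 1) (2 * t) := by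
  rw [laguerre_succ, sub_sub_cancel, intervalIntegral.integral_eq_sub_of_hasDerivAt
    (f := fun s => laguerrePrimitive j (2 * s))]
  · simp [laguerrePrimitive]
  · intro s _
    have h := (hasDerivAt_laguerrePrimitive j (2 * s)).comp s ((hasDerivAt_id s).const_mul 2)
    simpa [mul_comm, Function.comp_def] using h
  · exact ((continuous_const.mul ((continuous_laguerre j).comp (by fun_prop)))).intervalIntegrable
      _ _

end Laguerre

/-- Since e^{-(t-s)}e^{-s} = e^{-t}, only the integral of 2Λ_j(2s) over (0, t) remains, and
`integral_laguerre` evaluates it. -/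
lemma convFun_cayleyKernel_psiFun (j : ℕ) {t : ℝ} (ht : 0 < t) :
    convFun cayleyKernel (psiFun j) t = psiFun (j + 1) t - psiFun j t := by
  have e : (fun s : ℝ => cayleyKernel (t - s) * psiFun j s) =
      (Set.Ioo (0 : ℝ) t).indicator fun s =>
        ((-(√2 * Real.exp (-t)) * (2 * laguerre j (2 * s)) : ℝ) : ℂ) := by
    funext s
    unfold cayleyKernel psiFun
    by_cases h0 : 0 < s
    · by_cases h1 : s < t
      · rw [Set.indicator_of_mem (by simpa using h1), Set.indicator_of_mem (by exact h0),
          Set.indicator_of_mem (by exact ⟨h0, h1⟩), ← ofReal_mul]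
        congr 1
        rw [show -t = -(t - s) + -s by ring, Real.exp_add]
        ring
      · rw [Set.indicator_of_notMem (by simpa using h1), zero_mul,
          Set.indicator_of_notMem fun h => h1 h.2]
    · rw [Set.indicator_of_notMem (s := Set.Ioi 0) (a := s) (by exact h0), mul_zero,
        Set.indicator_of_notMem fun h => h0 h.1]
  rw [convFun, e, integral_indicator measurableSet_Ioo, integral_complex_ofReal,
    ← integral_Ioc_eq_integral_Ioo, ← intervalIntegral.integral_of_le ht.le,
    intervalIntegral.integral_const_mul, integral_laguerre, psiFun, psiFun,
    Set.indicator_of_mem (by exact ht), Set.indicator_of_mem (by exact ht), ← ofReal_sub]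
  congr 1
  ring

/-- The integrand lives on s > max(t, 0), which handles both signs of t at once: the value is -√2
e^{-t} for t > 0 and -√2 e^{t} for t < 0. -/
lemma convFun_reflect_cayleyKernel_psiFun (t : ℝ) :
    convFun (fun s => cayleyKernel (-s)) (psiFun 0) t =
      ((-(√2 * Real.exp (t - 2 * max t 0)) : ℝ) : ℂ) := by
  have e : (fun s : ℝ => cayleyKernel (-(t - s)) * psiFun 0 s) =
      (Set.Ioi (max t 0)).indicator fun s =>
        ((-2 * (√2 * Real.exp t) * Real.exp (-2 * s) : ℝ) : ℂ) := by
    funext s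
    unfold cayleyKernel psiFun
    by_cases h0 : 0 < s
    · by_cases h1 : t < s
      · rw [Set.indicator_of_mem (by simpa using h1), Set.indicator_of_mem (by exact h0),
          Set.indicator_of_mem (by exact max_lt h1 h0), ← ofReal_mul]
        congr 1
        rw [show -2 * s = -s + -s by ring, Real.exp_add, show - -(t - s) = t + -s by ring,
          Real.exp_add]
        simp [laguerre]
        ring
      · rw [Set.indicator_of_notMem (by simpa using h1), zero_mul,
          Set.indicator_of_notMem fun h => h1 ((le_max_left _ _).trans_lt (Set.mem_Ioi.1 h))]
    · rw [Set.indicator_of_notMem (s := Set.Ioi 0) (a := s) (by exact h0), mul_zero,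
        Set.indicator_of_notMem fun h => h0 ((le_max_right _ _).trans_lt (Set.mem_Ioi.1 h))]
  rw [convFun, e, integral_indicator measurableSet_Ioi, integral_complex_ofReal,
    integral_const_mul, integral_exp_mul_Ioi (by norm_num)]
  congr 1
  rw [sub_eq_add_neg, Real.exp_add, ← neg_mul 2]
  ring

/-! ### The shift relations for ψ_j in L^p -/

section Psi

variable (p : ℝ≥0∞) [Fact (1 ≤ p)]

omit [Fact (1 ≤ p)] in
lemma psi_coe (j : ℕ) : (psi p j : Lp ℂ p (volume : Measure ℝ)) =ᵐ[volume] psiFun j :=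
  (memLp_psiFun p j).coeFn_toLp

lemma Rep.op_eq_add_conv {r : Rep} (hr : r.coeff = Pi.single 0 1)
    (f : Lp ℂ p (volume : Measure ℝ)) :
    r.op p f = f + conv p r.kernel r.integrable_kernel f := by
  rw [Rep.op_eq, add_apply, hr, discOp_single, one_smul, Rep.kernelL1, convL_toL1]

lemma W0_cayley_psi (j : ℕ) : W0 p cayley (psi p j) = psi p (j + 1) := by
  rw [← symbol_cayleyRep, W0_symbol, Rep.op_eq_add_conv p (by rfl)]
  refine Lp.ext ?_
  filter_upwards [Lp.coeFn_add (psi p j : Lp ℂ p (volume : Measure ℝ))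
    (conv p cayleyRep.kernel cayleyRep.integrable_kernel (psi p j)), psi_coe p j,
    psi_coe p (j + 1), conv_coe p cayleyRep.integrable_kernel (psi p j), ae_ne_zero]
    with t h1 h2 h3 h4 h5
  rw [h1, Pi.add_apply, h2, h3, h4, convFun_congr (psi_coe p j)]
  rcases lt_or_gt_of_ne h5 with ht | ht
  · rw [psiFun_of_neg _ ht, psiFun_of_neg _ ht, cayleyRep, convFun_eq_zero_of_neg
      (Filter.Eventually.of_forall fun s hs => cayleyKernel_of_neg hs)
      (Filter.Eventually.of_forall fun s hs => psiFun_of_neg j hs) ht, add_zero]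
  · simp only [cayleyRep]
    rw [convFun_cayleyKernel_psiFun j ht, add_sub_cancel]

/-- On the positive semi-axis the convolution cancels the identity term ψ_0; on the negative one it
leaves -√2 e^{t}. This is the step at which the backward shift leaves L^p(ℝ⁺). -/
lemma W0_cayley_inv_psi_zero :
    W0 p cayley⁻¹ (psi p 0) = -reflection p (psi p 0) := by
  have hs : cayleyRep.reflect.symbol = cayley⁻¹ := by
    rw [Rep.symbol_reflect, symbol_cayleyRep]
    exact funext cayley_neg
  have hc : cayleyRep.reflect.coeff = Pi.single 0 1 := by
    funext δ
    simp only [Rep.reflect, cayleyRep, Pi.single_apply, neg_eq_zero]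
  rw [← hs, W0_symbol, Rep.op_eq_add_conv p hc]
  refine Lp.ext ?_
  filter_upwards [Lp.coeFn_add (psi p 0 : Lp ℂ p (volume : Measure ℝ))
    (conv p cayleyRep.reflect.kernel cayleyRep.reflect.integrable_kernel (psi p 0)), psi_coe p 0,
    conv_coe p cayleyRep.reflect.integrable_kernel (psi p 0), ae_ne_zero,
    Lp.coeFn_neg (reflection p (psi p 0)), reflection_coe p (psi p 0), ae_neg (psi_coe p 0)]
    with t h1 h2 h4 h5 h6 h7 h8
  rw [h1, Pi.add_apply, h2, h4, h6, Pi.neg_apply, h7, h8, convFun_congr (psi_coe p 0)]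
  simp only [Rep.reflect, cayleyRep]
  rw [convFun_reflect_cayleyKernel_psiFun]
  unfold psiFun
  rcases lt_or_gt_of_ne h5 with ht | ht
  · rw [Set.indicator_of_notMem (by simpa using ht.le), Set.indicator_of_mem (by simpa using ht),
      max_eq_right ht.le]
    simp [laguerre]
  · rw [Set.indicator_of_mem (by simpa using ht), Set.indicator_of_notMem (by simpa using ht.le),
      max_eq_left ht.le, show t - 2 * t = -t by ring]
    simp [laguerre]

omit [Fact (1 ≤ p)] in
lemma psi_zero_ne_zero : psi p 0 ≠ 0 := fun h => by
  have h1 := psi_coe p 0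
  rw [h] at h1
  have h2 : ∀ᵐ t : ℝ, t ∉ Set.Ioi (0 : ℝ) := by
    filter_upwards [h1, Lp.coeFn_zero ℂ p (volume : Measure ℝ)] with t h3 h4 ht
    rw [psiFun, Set.indicator_of_mem ht] at h3
    have h5 : ((√2 * Real.exp (-t) * laguerre 0 (2 * t) : ℝ) : ℂ) = 0 := h3.symm.trans h4
    simp [laguerre] at h5
  have h3 : volume (Set.Ioi (0 : ℝ)) = 0 := by
    simpa only [ae_iff, not_not, Set.ofPred_mem_eq] using h2
  simp at h3

end Psi

/-! ### Linear algebra of the vectors e_j - τ e_{n-1-j} -/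

section LinearAlgebra

variable {V : Type*} [AddCommGroup V] [Module ℂ V]

/-- If N is the largest index in a vanishing combination, T^N kills every term except the last,
which becomes a nonzero multiple of v_0. -/
lemma linearIndependent_of_backward_shift {v : ℕ → V} (T : V →ₗ[ℂ] V) (h0 : v 0 ≠ 0)
    (hT0 : T (v 0) = 0) (hT : ∀ j, T (v (j + 1)) = v j) : LinearIndependent ℂ v := by
  have h1 : ∀ N j, (T ^ N) (v (N + j)) = v j := fun N => by
    induction N with
    | zero => simp
    | succ N ih =>
      intro j
      rw [pow_succ, Module.End.mul_apply, Nat.add_right_comm, hT, ih]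
  have h2 : ∀ N j, j < N → (T ^ N) (v j) = 0 := fun N j hj => by
    obtain ⟨d, rfl⟩ := Nat.exists_eq_add_of_lt hj
    have := h1 j 0
    rw [add_zero] at this
    rw [show j + d + 1 = d + 1 + j by ring, pow_add, Module.End.mul_apply, this, pow_succ,
      Module.End.mul_apply, hT0, map_zero]
  rw [linearIndependent_iff]
  intro l hl
  by_contra hne
  have hs : l.support.Nonempty := Finsupp.support_nonempty_iff.2 hne
  set N := l.support.max' hs with hN
  have hmem : N ∈ l.support := Finset.max'_mem _ _
  have h3 := congrArg (T ^ N) hl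
  rw [map_zero, Finsupp.linearCombination_apply, Finsupp.sum, map_sum,
    Finset.sum_eq_single_of_mem N hmem, map_smul] at h3
  · have h4 := h1 N 0
    rw [add_zero] at h4
    rw [h4, smul_eq_zero] at h3
    exact h3.elim (Finsupp.mem_support_iff.1 hmem) h0
  · intro j hj hjN
    rw [map_smul, h2 N j (lt_of_le_of_ne (Finset.le_max' _ _ hj) hjN), smul_zero]

/-- Each coefficient vector has a coordinate at which all the others vanish; reading off that
coordinate isolates its scalar. -/
lemma linearIndependent_of_pivot {ι : Type*} {e : ℕ → V} (he : LinearIndependent ℂ e)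
    (w : ι → ℕ →₀ ℂ) (s : ι → ℕ) (hd : ∀ k, w k (s k) ≠ 0) (ho : ∀ i k, i ≠ k → w i (s k) = 0) :
    LinearIndependent ℂ fun k => Finsupp.linearCombination ℂ e (w k) := by
  have hw : LinearIndependent ℂ w := by
    rw [linearIndependent_iff']
    intro t c hc k hk
    have h := DFunLike.congr_fun hc (s k)
    rw [Finsupp.finsetSum_apply, Finset.sum_eq_single_of_mem k hk] at h
    · simpa [hd k] using h
    · intro i _ hik
      simp [ho i k hik]
  exact hw.map' _ (LinearMap.ker_eq_bot.2 he)

lemma linearIndependent_even_system {e : ℕ → V} (he : LinearIndependent ℂ e) {τ : ℂ}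
    (hτ : τ ≠ 0) (m : ℕ) :
    LinearIndependent ℂ fun k : Fin m => e (m - k - 1) - τ • e (m + k) := by
  have h := linearIndependent_of_pivot he
    (fun k : Fin m => Finsupp.single (m - k - 1) (1 : ℂ) - Finsupp.single (m + k) τ)
    (fun k => m + k)
    (fun k => by
      have : m - (k : ℕ) - 1 ≠ m + k := by have := k.2; omega
      simp [this, hτ])
    (fun i k hik => by
      have h1 : m - (i : ℕ) - 1 ≠ m + k := by have := i.2; omega
      simp [h1, Fin.val_ne_of_ne hik])
  simpa only [map_sub, Finsupp.linearCombination_single, one_smul] using h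

lemma odd_system_eq_zero_iff {e : ℕ → V} (he : LinearIndependent ℂ e) {τ : ℂ} {m : ℕ}
    (k : Fin (m + 1)) : e (m + k) - τ • e (m - k) = 0 ↔ k = 0 ∧ τ = 1 := by
  constructor
  · intro h
    have h1 : Finsupp.linearCombination ℂ e
        (Finsupp.single (m + (k : ℕ)) (1 : ℂ) - Finsupp.single (m - (k : ℕ)) τ) = 0 := by
      simpa using h
    have h2 := DFunLike.congr_fun (linearIndependent_iff.1 he _ h1) (m + k)
    by_cases hk : k = 0
    · subst hk
      refine ⟨rfl, ?_⟩
      simp only [Fin.val_zero, add_zero, tsub_zero, Finsupp.sub_apply, Finsupp.single_eq_same,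
        Finsupp.zero_apply] at h2
      exact (sub_eq_zero.1 h2).symm
    · have h3 : m - (k : ℕ) ≠ m + k := by
        have := Fin.val_ne_of_ne hk
        simp only [Fin.val_zero] at this
        omega
      simp [h3] at h2
  · rintro ⟨rfl, rfl⟩
    simp

/-- The pivot is the coordinate m + k. It meets an index of the form m - i only for i = k = 0, where
the coefficient is 1 - τ; hence the excluded case. -/
lemma linearIndependent_odd_system {e : ℕ → V} (he : LinearIndependent ℂ e) (τ : ℂ) (m : ℕ) :
    LinearIndependent ℂ fun k : {k : Fin (m + 1) // ¬(k = 0 ∧ τ = 1)} =>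
      e (m + k.1) - τ • e (m - k.1) := by
  have h := linearIndependent_of_pivot he
    (fun k : {k : Fin (m + 1) // ¬(k = 0 ∧ τ = 1)} =>
      Finsupp.single (m + (k.1 : ℕ)) (1 : ℂ) - Finsupp.single (m - (k.1 : ℕ)) τ)
    (fun k => m + k.1)
    (fun ⟨k, hk⟩ => by
      by_cases hk0 : k = 0
      · have : τ ≠ 1 := fun h => hk ⟨hk0, h⟩
        subst hk0
        simpa [sub_eq_zero] using this.symm
      · have h3 : m - (k : ℕ) ≠ m + k := by
          have := Fin.val_ne_of_ne hk0
          simp only [Fin.val_zero] at this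
          omega
        simp [h3])
    (fun ⟨i, _⟩ ⟨k, _⟩ hik => by
      have hik' : (i : ℕ) ≠ k := fun h => hik (Subtype.ext (Fin.ext h))
      have h2 : m - (i : ℕ) ≠ m + k := by omega
      simp [hik', h2])
  simpa only [map_sub, Finsupp.linearCombination_single, one_smul] using h

/-- Because τ² = 1, e_{n-1-j} - τ e_j = -τ(e_j - τ e_{n-1-j}). The n generators on the right
therefore come in proportional pairs, with one representative of each on the left. -/
lemma span_even_system (e : ℕ → V) {τ : ℂ} (hτ : τ * τ = 1) (m : ℕ) :
    Submodule.span ℂ (Set.range fun k : Fin m => e (m - k - 1) - τ • e (m + k)) =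
      Submodule.span ℂ
        (Set.range fun j : Fin (2 * m) => (1 / 2 : ℂ) • (e j - τ • e (2 * m - 1 - j))) := by
  refine le_antisymm (Submodule.span_le.2 ?_) (Submodule.span_le.2 ?_)
  · rintro _ ⟨k, rfl⟩
    have hk := k.2
    have h := Submodule.smul_mem _ (2 : ℂ) (Submodule.subset_span (R := ℂ) (Set.mem_range_self
      (f := fun j : Fin (2 * m) => (1 / 2 : ℂ) • (e j - τ • e (2 * m - 1 - j)))
      ⟨m - k - 1, by omega⟩))
    simp only at h
    rw [show 2 * m - 1 - (m - (k : ℕ) - 1) = m + k by omega, smul_smul] at h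
    simpa using h
  · rintro _ ⟨j, rfl⟩
    have hj := j.2
    refine Submodule.smul_mem _ _ ?_
    -- The lower half j = m - k - 1 gives the chosen representatives; the upper half j = m + k gives
    -- their multiples by -τ.
    rcases lt_or_ge (j : ℕ) m with h | h
    · refine Submodule.subset_span ⟨⟨m - 1 - j, by omega⟩, ?_⟩
      simp only
      rw [show m - (m - 1 - (j : ℕ)) - 1 = j by omega,
        show m + (m - 1 - (j : ℕ)) = 2 * m - 1 - j by omega]
    · have h' := Submodule.smul_mem _ (-τ) (Submodule.subset_span (R := ℂ) (Set.mem_range_self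
        (f := fun k : Fin m => e (m - k - 1) - τ • e (m + k)) ⟨j - m, by omega⟩))
      simp only at h'
      rw [show m - ((j : ℕ) - m) - 1 = 2 * m - 1 - j by omega,
        show m + ((j : ℕ) - m) = j by omega, smul_sub, smul_smul, neg_mul, hτ] at h'
      convert h' using 1
      simp only [neg_smul, one_smul]
      abel

lemma span_odd_system (e : ℕ → V) {τ : ℂ} (hτ : τ * τ = 1) (m : ℕ) :
    Submodule.span ℂ (Set.range fun k : Fin (m + 1) => e (m + k) - τ • e (m - k)) =
      Submodule.span ℂ
        (Set.range fun j : Fin (2 * m + 1) => (1 / 2 : ℂ) • (e j - τ • e (2 * m + 1 - 1 - j))) := by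
  refine le_antisymm (Submodule.span_le.2 ?_) (Submodule.span_le.2 ?_)
  · rintro _ ⟨k, rfl⟩
    have hk := k.2
    have h := Submodule.smul_mem _ (2 : ℂ) (Submodule.subset_span (R := ℂ) (Set.mem_range_self
      (f := fun j : Fin (2 * m + 1) => (1 / 2 : ℂ) • (e j - τ • e (2 * m + 1 - 1 - j)))
      ⟨m + k, by omega⟩))
    simp only at h
    rw [show 2 * m + 1 - 1 - (m + (k : ℕ)) = m - k by omega, smul_smul] at h
    simpa using h
  · rintro _ ⟨j, rfl⟩
    have hj := j.2
    refine Submodule.smul_mem _ _ ?_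
    rcases le_or_gt m (j : ℕ) with h | h
    · refine Submodule.subset_span ⟨⟨j - m, by omega⟩, ?_⟩
      simp only
      rw [show m + ((j : ℕ) - m) = j by omega,
        show m - ((j : ℕ) - m) = 2 * m + 1 - 1 - j by omega]
    · have h' := Submodule.smul_mem _ (-τ) (Submodule.subset_span (R := ℂ) (Set.mem_range_self
        (f := fun k : Fin (m + 1) => e (m + k) - τ • e (m - k)) ⟨m - j, by omega⟩))
      simp only at h'
      rw [show m + (m - (j : ℕ)) = 2 * m + 1 - 1 - j by omega,
        show m - (m - (j : ℕ)) = j by omega, smul_sub, smul_smul, neg_mul, hτ] at h'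
      convert h' using 1
      simp only [neg_smul, one_smul]
      abel

/-- Removing the middle vector when τ = 1 leaves m independent vectors, and m + 1 remain when τ =
-1. The count is stated in ℂ because τ is complex. -/
lemma finrank_span_odd_system {e : ℕ → V} (he : LinearIndependent ℂ e) {τ : ℂ}
    (hτ : τ = 1 ∨ τ = -1) (m : ℕ) :
    (Module.finrank ℂ (Submodule.span ℂ
      (Set.range fun k : Fin (m + 1) => e (m + k) - τ • e (m - k))) : ℂ) = m + (1 - τ) / 2 := by
  have hspan : Submodule.span ℂ (Set.range fun k : Fin (m + 1) => e (m + k) - τ • e (m - k)) =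
      Submodule.span ℂ (Set.range fun k : {k : Fin (m + 1) // ¬(k = 0 ∧ τ = 1)} =>
        e (m + k.1) - τ • e (m - k.1)) := by
    refine le_antisymm (Submodule.span_le.2 ?_) (Submodule.span_mono ?_)
    · rintro _ ⟨k, rfl⟩
      by_cases hk : k = 0 ∧ τ = 1
      · simp only
        rw [(odd_system_eq_zero_iff he k).2 hk]
        exact Submodule.zero_mem _
      · exact Submodule.subset_span ⟨⟨k, hk⟩, rfl⟩
    · rintro _ ⟨k, rfl⟩
      exact ⟨k.1, rfl⟩
  classical
  rw [hspan, finrank_span_eq_card (linearIndependent_odd_system he τ m)]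
  rcases hτ with rfl | rfl
  · simp
  · have h1 : ¬((-1 : ℂ) = 1) := by norm_num
    simp only [h1, and_false, not_false_eq_true]
    rw [Fintype.card_subtype_true, Fintype.card_fin]
    push_cast
    norm_num

/-- The form used in the theorem, with e_j = W(g₊⁻¹)ψ_j, τ = εσ and R the image of 𝐏^±(g). -/
lemma even_system_basis {e : ℕ → V} (he : LinearIndependent ℂ e) {τ : ℂ}
    (hτ : τ = 1 ∨ τ = -1) {m : ℕ} {u : Fin m → V}
    (hu : ∀ k, u k = e (m - k - 1) - τ • e (m + k)) {R : Submodule ℂ V}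
    (hR : R = Submodule.span ℂ
      (Set.range fun j : Fin (2 * m) => (1 / 2 : ℂ) • (e j - τ • e (2 * m - 1 - j)))) :
    LinearIndependent ℂ u ∧ Submodule.span ℂ (Set.range u) = R ∧ Module.finrank ℂ R = m := by
  obtain rfl := funext hu
  have hττ := mul_self_eq_one_iff.2 hτ
  have hli := linearIndependent_even_system he (left_ne_zero_of_mul_eq_one hττ) m
  have hspan := (span_even_system e hττ m).trans hR.symm
  refine ⟨hli, hspan, ?_⟩
  rw [← hspan, finrank_span_eq_card hli, Fintype.card_fin]

lemma odd_system_basis {e : ℕ → V} (he : LinearIndependent ℂ e) {τ : ℂ}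
    (hτ : τ = 1 ∨ τ = -1) {m : ℕ} {u : Fin (m + 1) → V}
    (hu : ∀ k, u k = e (m + k) - τ • e (m - k)) {R : Submodule ℂ V}
    (hR : R = Submodule.span ℂ
      (Set.range fun j : Fin (2 * m + 1) => (1 / 2 : ℂ) • (e j - τ • e (2 * m + 1 - 1 - j)))) :
    (∀ k, u k = 0 ↔ k = 0 ∧ τ = 1) ∧
      LinearIndependent ℂ (fun k : {k : Fin (m + 1) // u k ≠ 0} => u k) ∧
      Submodule.span ℂ (Set.range u) = R ∧ (Module.finrank ℂ R : ℂ) = m + (1 - τ) / 2 := by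
  obtain rfl := funext hu
  have hspan := (span_odd_system e (mul_self_eq_one_iff.2 hτ) m).trans hR.symm
  have hzero := fun k : Fin (m + 1) => odd_system_eq_zero_iff he (τ := τ) k
  refine ⟨hzero, ?_, hspan, by rw [← hspan]; exact finrank_span_odd_system he hτ m⟩
  let f : {k : Fin (m + 1) // e (m + k) - τ • e (m - k) ≠ 0} →
      {k : Fin (m + 1) // ¬(k = 0 ∧ τ = 1)} := fun k => ⟨k.1, fun h => k.2 ((hzero k.1).2 h)⟩
  have hf : Function.Injective f := fun i j hij => Subtype.ext (congrArg (fun x => x.1) hij)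
  exact (linearIndependent_odd_system he τ m).comp f hf

end LinearAlgebra

/-! ### The factorization of a matching function -/

section Factorization

lemma cayley_zero : cayley 0 = -1 := by
  rw [cayley, div_eq_iff (add_I_ne_zero 0)]
  simp

variable {g gm gp : ℝ → ℂ} {n : ℕ}

lemma IsFactorization.eq_mul_pow (h : IsFactorization g gm gp (-(n : ℤ))) :
    g = gm * cayley⁻¹ ^ n * gp := by
  funext t
  rw [h.eq_mul, zpow_neg, zpow_natCast]
  simp [cayley]

lemma IsFactorization.sigma_eq (h : IsFactorization g gm gp (-(n : ℤ))) : sigma g n = gp 0 := by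
  rw [sigma, h.eq_mul_pow]
  simp only [Pi.mul_apply, Pi.pow_apply, Pi.inv_apply, h.minus_zero, cayley_zero, one_mul]
  rw [← mul_assoc, ← mul_pow]
  norm_num

lemma sigma_mul_self (hg : ∀ t : ℝ, g t * g (-t) = 1) (n : ℕ) : sigma g n * sigma g n = 1 := by
  have h := hg 0
  rw [neg_zero] at h
  rw [sigma, mul_mul_mul_comm, h, ← mul_pow]
  norm_num

/-- The product g₋ g̃₊ lies in G⁻ by its form and in G⁺ because it is the inverse of g̃₋ g₊; so it
is the constant g₊(0) = σ(g). -/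
lemma IsFactorization.minus_eq (h : IsFactorization g gm gp (-(n : ℤ)))
    (hg : ∀ t : ℝ, g t * g (-t) = 1) (t : ℝ) : gm t = sigma g n * (gp (-t))⁻¹ := by
  -- In g(t)g(-t) = 1 the rational factors cancel, as c(-t) = c(t)⁻¹.
  have hinv : ∀ t, (gm t * gp (-t)) * (gm (-t) * gp t) = 1 := fun t => by
    have h1 := hg t
    rw [h.eq_mul_pow] at h1
    simp only [Pi.mul_apply, Pi.pow_apply, Pi.inv_apply, cayley_neg, inv_inv] at h1
    have h2 : (cayley t)⁻¹ ^ n * cayley t ^ n = 1 := by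
      rw [← mul_pow, inv_mul_cancel₀ (cayley_ne_zero t), one_pow]
    linear_combination h1 - (gm t * gp (-t)) * (gm (-t) * gp t) * h2
  have hminus : (fun t => gm t * gp (-t)) ∈ GMinus :=
    mul_mem_GMinus h.minus_mem (reflect_mem_GMinus h.plus_mem)
  have hplus : (fun t => gm t * gp (-t)) ∈ GPlus := by
    convert mul_mem_GPlus (reflect_mem_GPlus h.minus_inv_mem) h.plus_inv_mem using 1
    funext t
    simp only [Pi.mul_apply, Pi.inv_apply]
    rw [← mul_inv, eq_inv_of_mul_eq_one_left (hinv t)]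
  have hc := eq_const_of_mem_GPlus_of_mem_GMinus hplus hminus t
  rw [h.minus_zero, neg_zero, one_mul, ← h.sigma_eq] at hc
  rw [← hc, mul_inv_cancel_right₀ (h.plus_ne_zero _)]

end Factorization

/-! ### The kernel of W(g) and the action of 𝐏(g) on it -/

section Kernel

variable (p : ℝ≥0∞) [Fact (1 ≤ p)]

lemma W0_pow {a : ℝ → ℂ} (ha : a ∈ G) (n : ℕ) : a ^ n ∈ G ∧ W0 p (a ^ n) = W0 p a ^ n := by
  induction n with
  | zero =>
    rw [pow_zero, pow_zero]
    refine ⟨GPlus_subset_G (const_mem_GPlus 1), ContinuousLinearMap.ext fun f => ?_⟩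
    exact (W0_const p 1 f).trans (one_smul ℂ f)
  | succ n ih =>
    rw [pow_succ, pow_succ]
    exact ⟨mul_mem_G ih.1 ha, by rw [W0_mul p ih.1 ha, ih.2]⟩

lemma W0_mul_inv {a b : ℝ → ℂ} (ha : a ∈ G) (hb : b ∈ G) (hab : ∀ t, a t * b t = 1) :
    W0 p a * W0 p b = 1 := by
  rw [← W0_mul p ha hb, show a * b = fun _ => 1 from funext hab]
  exact ContinuousLinearMap.ext fun f => (W0_const p 1 f).trans (one_smul ℂ f)

lemma cayley_mem_G : cayley ∈ G := GPlus_subset_G cayley_mem_GPlus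

lemma cayley_inv_mem_G : cayley⁻¹ ∈ G := GMinus_subset_G cayley_inv_mem_GMinus

lemma W0_cayley_inv_mul : W0 p cayley⁻¹ * W0 p cayley = 1 :=
  W0_mul_inv p cayley_inv_mem_G cayley_mem_G fun t => inv_mul_cancel₀ (cayley_ne_zero t)

lemma W0_cayley_inv_psi_succ (j : ℕ) :
    W0 p cayley⁻¹ (psi p (j + 1)) = psi p j := by
  rw [← W0_cayley_psi, ← mul_apply_eq_comp, W0_cayley_inv_mul, one_apply_eq_self]

/-- Under J the operator W⁰(c⁻¹) becomes W⁰(c), so it shifts the reflected functions forward. -/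
lemma W0_cayley_inv_pow_reflection_psi (j : ℕ) :
    (W0 p cayley⁻¹ ^ j) (reflection p (psi p 0)) = reflection p (psi p j) := by
  induction j with
  | zero => rw [pow_zero, one_apply_eq_self]
  | succ j ih =>
    rw [pow_succ', mul_apply_eq_comp, ih, ← W0_cayley_psi, reflection_W0 p cayley_mem_G]
    congr 2
    exact (funext cayley_neg).symm

/-- Among the i + j + 1 steps, j lower ψ_j to ψ_0, one crosses to -Jψ_0, and the remaining i raise
the reflected index. -/
lemma W0_cayley_inv_pow_psi (i j : ℕ) :
    (W0 p cayley⁻¹ ^ (i + (j + 1))) (psi p j) = -reflection p (psi p i) := by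
  induction j with
  | zero =>
    rw [zero_add, pow_succ, mul_apply_eq_comp, W0_cayley_inv_psi_zero, map_neg,
      W0_cayley_inv_pow_reflection_psi]
  | succ j ih =>
    rw [← add_assoc, pow_succ, mul_apply_eq_comp, W0_cayley_inv_psi_succ, ih]

lemma W_coe (a : ℝ → ℂ) (f : LpPlus p) :
    (W p a f : Lp ℂ p (volume : Measure ℝ)) = projP p (W0 p a f) := rfl

lemma W_coe_of_mem_GPlus {a : ℝ → ℂ} (ha : a ∈ GPlus) (f : LpPlus p) :
    (W p a f : Lp ℂ p (volume : Measure ℝ)) = W0 p a f :=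
  (mem_LpPlus_iff_projP p).1 (W0_mem_LpPlus p ha f.2)

/-- The difference Pf - f lies in ker P, which W⁰(a) preserves. -/
lemma projP_W0_projP {a : ℝ → ℂ} (ha : a ∈ GMinus) (f : Lp ℂ p (volume : Measure ℝ)) :
    projP p (W0 p a (projP p f)) = projP p (W0 p a f) := by
  have h : projP p (projP p f - f) = 0 := by
    rw [map_sub, (mem_LpPlus_iff_projP p).1 (projP_mem p f), sub_self]
  have h' := projP_W0_eq_zero p ha h
  rwa [map_sub, map_sub, sub_eq_zero] at h'

lemma projP_reflection (f : LpPlus p) : projP p (reflection p f) = 0 := by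
  rw [projP_eq_zero_iff, reflection_reflection]
  exact f.2

/-- The functions `ψ_j` are linearly independent: compress multiplication by `(t + i)/(t - i)` to
the semi-axis. -/
lemma linearIndependent_psi :
    LinearIndependent ℂ fun j => (psi p j : Lp ℂ p (volume : Measure ℝ)) := by
  refine linearIndependent_of_backward_shift ((projP p ∘L W0 p cayley⁻¹).toLinearMap)
    (fun h => psi_zero_ne_zero p (Subtype.ext h)) ?_ fun j => ?_
  · change projP p (W0 p cayley⁻¹ (psi p 0)) = 0
    rw [W0_cayley_inv_psi_zero, map_neg, projP_reflection, neg_zero]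
  · change projP p (W0 p cayley⁻¹ (psi p (j + 1))) = _
    rw [W0_cayley_inv_psi_succ]
    exact (mem_LpPlus_iff_projP p).1 (psi p j).2

variable {g gm gp : ℝ → ℂ} {n : ℕ}

namespace IsFactorization

lemma W0_minus_mul_inv {κ : ℤ} (h : IsFactorization g gm gp κ) : W0 p gm * W0 p gm⁻¹ = 1 :=
  W0_mul_inv p (GMinus_subset_G h.minus_mem) (GMinus_subset_G h.minus_inv_mem) fun t =>
    mul_inv_cancel₀ (h.minus_ne_zero t)

lemma W0_plus_mul_inv {κ : ℤ} (h : IsFactorization g gm gp κ) : W0 p gp * W0 p gp⁻¹ = 1 :=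
  W0_mul_inv p (GPlus_subset_G h.plus_mem) (GPlus_subset_G h.plus_inv_mem) fun t =>
    mul_inv_cancel₀ (h.plus_ne_zero t)

lemma W0_eq (h : IsFactorization g gm gp (-(n : ℤ))) :
    W0 p g = W0 p gm * W0 p cayley⁻¹ ^ n * W0 p gp := by
  have hc := W0_pow p cayley_inv_mem_G n
  rw [h.eq_mul_pow, W0_mul p (mul_mem_G (GMinus_subset_G h.minus_mem) hc.1)
    (GPlus_subset_G h.plus_mem), W0_mul p (GMinus_subset_G h.minus_mem) hc.1, hc.2]

lemma W0_apply_plus_inv (h : IsFactorization g gm gp (-(n : ℤ)))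
    (f : Lp ℂ p (volume : Measure ℝ)) :
    W0 p g (W0 p gp⁻¹ f) = W0 p gm ((W0 p cayley⁻¹ ^ n) f) := by
  rw [← mul_apply_eq_comp, h.W0_eq p, mul_assoc, h.W0_plus_mul_inv p, mul_one, mul_apply_eq_comp]

/-- An explicit right inverse: y ↦ W⁰(g₊⁻¹)W⁰(cⁿ)P W⁰(g₋⁻¹)y. Applying W⁰(g) leaves W⁰(g₋)P
W⁰(g₋⁻¹)y, and under the outer P the inner one may be dropped. -/
lemma surjective_W (h : IsFactorization g gm gp (-(n : ℤ))) : Function.Surjective (W p g) := by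
  intro y
  set z : Lp ℂ p (volume : Measure ℝ) := projP p (W0 p gm⁻¹ y) with hz
  have hmem : ∀ n : ℕ, (W0 p cayley ^ n) z ∈ LpPlus p := fun n => by
    induction n with
    | zero => exact projP_mem p _
    | succ n ih =>
      rw [pow_succ', mul_apply_eq_comp]
      exact W0_mem_LpPlus p cayley_mem_GPlus ih
  have hinv : (W0 p cayley⁻¹ ^ n) ((W0 p cayley ^ n) z) = z := by
    have hcomm : Commute (W0 p cayley⁻¹) (W0 p cayley) := by
      rw [Commute, SemiconjBy, ← W0_mul p cayley_inv_mem_G cayley_mem_G,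
        ← W0_mul p cayley_mem_G cayley_inv_mem_G, mul_comm]
    rw [← mul_apply_eq_comp, ← hcomm.mul_pow, W0_cayley_inv_mul, one_pow, one_apply_eq_self]
  refine ⟨⟨W0 p gp⁻¹ ((W0 p cayley ^ n) z), W0_mem_LpPlus p h.plus_inv_mem (hmem n)⟩,
    Subtype.ext ?_⟩
  rw [W_coe]
  simp only
  rw [h.W0_apply_plus_inv p, hinv, hz, projP_W0_projP p h.minus_mem,
    ← mul_apply_eq_comp (W0 p gm), h.W0_minus_mul_inv p, one_apply_eq_self]
  exact (mem_LpPlus_iff_projP p).1 y.2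

lemma finrank_ker_W (h : IsFactorization g gm gp (-(n : ℤ)))
    (hindex : (W p g).toLinearMap.index = (n : ℤ)) : Module.finrank ℂ (W p g).ker = n := by
  have hr : LinearMap.range (W p g).toLinearMap = ⊤ := LinearMap.range_eq_top.2 (h.surjective_W p)
  have hq : Module.finrank ℂ (LpPlus p ⧸ LinearMap.range (W p g).toLinearMap) = 0 := by
    have : Subsingleton (LpPlus p ⧸ LinearMap.range (W p g).toLinearMap) :=
      Submodule.Quotient.subsingleton_iff.2 hr
    exact Module.finrank_zero_of_subsingleton
  rw [LinearMap.index, hq] at hindex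
  simpa using hindex

/-- The central computation. The factor g₊ cancels, c⁻ⁿ sends ψ_j to -Jψ_{n-1-j}, and g₋ is the
reflection of σ g₊⁻¹, so W⁰(g₋) passes through J as σ W⁰(g₊⁻¹). -/
lemma W0_apply_plus_inv_psi (h : IsFactorization g gm gp (-(n : ℤ)))
    (hg : ∀ t : ℝ, g t * g (-t) = 1) {j : ℕ} (hj : j < n) :
    W0 p g (W p gp⁻¹ (psi p j)) =
      -(sigma g n • reflection p (W p gp⁻¹ (psi p (n - 1 - j)))) := by
  have hpow := W0_cayley_inv_pow_psi p (n - 1 - j) j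
  rw [show n - 1 - j + (j + 1) = n by omega] at hpow
  have hgm : gm = fun t => ((fun _ => sigma g n) * gp⁻¹ : ℝ → ℂ) (-t) :=
    funext (h.minus_eq hg)
  have hG : gp⁻¹ ∈ G := GPlus_subset_G h.plus_inv_mem
  have hσ : (fun _ => sigma g n : ℝ → ℂ) ∈ G := GPlus_subset_G (const_mem_GPlus _)
  rw [W_coe_of_mem_GPlus p h.plus_inv_mem, W_coe_of_mem_GPlus p h.plus_inv_mem,
    h.W0_apply_plus_inv p, hpow, map_neg, hgm, ← reflection_W0 p (mul_mem_G hσ hG), W0_mul p hσ hG,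
    mul_apply_eq_comp, W0_const, map_smul]

lemma mem_ker_W (h : IsFactorization g gm gp (-(n : ℤ)))
    (hg : ∀ t : ℝ, g t * g (-t) = 1) {j : ℕ} (hj : j < n) :
    W p gp⁻¹ (psi p j) ∈ (W p g).ker := by
  refine LinearMap.mem_ker.2 (Subtype.ext ?_)
  change projP p (W0 p g (W p gp⁻¹ (psi p j))) = 0
  rw [h.W0_apply_plus_inv_psi p hg hj, map_neg, map_smul, projP_reflection, smul_zero, neg_zero]

lemma matchingOp_apply (h : IsFactorization g gm gp (-(n : ℤ)))
    (hg : ∀ t : ℝ, g t * g (-t) = 1) {j : ℕ} (hj : j < n) :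
    matchingOp p g ⟨W p gp⁻¹ (psi p j), h.mem_ker_W p hg hj⟩ =
      -(sigma g n • W p gp⁻¹ (psi p (n - 1 - j))) := by
  refine Subtype.ext ?_
  change reflection p (projQ p (W0 p g (projP p (W p gp⁻¹ (psi p j))))) = _
  rw [(mem_LpPlus_iff_projP p).1 (W p gp⁻¹ (psi p j)).2, h.W0_apply_plus_inv_psi p hg hj,
    projQ_apply, map_neg (projP p), map_smul (projP p), projP_reflection, smul_zero, neg_zero,
    sub_zero, map_neg, map_smul, reflection_reflection]
  rfl

lemma matchingProj_apply (h : IsFactorization g gm gp (-(n : ℤ)))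
    (hg : ∀ t : ℝ, g t * g (-t) = 1) (ε : ℂ) {j : ℕ} (hj : j < n) :
    matchingProj p g ε ⟨W p gp⁻¹ (psi p j), h.mem_ker_W p hg hj⟩ =
      (1 / 2 : ℂ) • (W p gp⁻¹ (psi p j) - (ε * sigma g n) • W p gp⁻¹ (psi p (n - 1 - j))) := by
  rw [matchingProj, LinearMap.smul_apply, LinearMap.add_apply, LinearMap.smul_apply,
    h.matchingOp_apply p hg hj, smul_neg, smul_smul, ← sub_eq_add_neg]
  rfl

/-- On L^p(ℝ⁺) the operator W(g₊⁻¹) is the restriction of W⁰(g₊⁻¹), which has the left inverse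
W⁰(g₊); independence of the ψ_j is thus preserved. -/
lemma linearIndependent_plus_inv_psi {κ : ℤ} (h : IsFactorization g gm gp κ) :
    LinearIndependent ℂ fun j => W p gp⁻¹ (psi p j) := by
  refine LinearIndependent.of_comp (LpPlus p).subtype ?_
  have hinj : LinearMap.ker (W0 p gp⁻¹).toLinearMap = ⊥ := by
    refine LinearMap.ker_eq_bot_of_inverse (g := (W0 p gp).toLinearMap) ?_
    exact LinearMap.ext fun f => DFunLike.congr_fun (h.W0_plus_mul_inv p) f
  have he : ((LpPlus p).subtype ∘ fun j => W p gp⁻¹ (psi p j)) = (W0 p gp⁻¹).toLinearMap ∘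
      fun j => (psi p j : Lp ℂ p (volume : Measure ℝ)) :=
    funext fun j => W_coe_of_mem_GPlus p h.plus_inv_mem (psi p j)
  rw [he]
  exact (linearIndependent_psi p).map' _ hinj

lemma range_matchingProj (h : IsFactorization g gm gp (-(n : ℤ)))
    (hg : ∀ t : ℝ, g t * g (-t) = 1) (hFredholm : (W p g).IsFredholm)
    (hindex : (W p g).toLinearMap.index = (n : ℤ)) (ε : ℂ) :
    LinearMap.range (matchingProj p g ε) = Submodule.span ℂ (Set.range fun j : Fin n =>
      (1 / 2 : ℂ) • (W p gp⁻¹ (psi p j) - (ε * sigma g n) • W p gp⁻¹ (psi p (n - 1 - j)))) := by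
  have hfin := hFredholm.finite_ker
  set e : Fin n → (W p g).ker := fun j => ⟨W p gp⁻¹ (psi p j), h.mem_ker_W p hg j.2⟩
  have hli : LinearIndependent ℂ e :=
    LinearIndependent.of_comp (W p g).ker.subtype
      ((h.linearIndependent_plus_inv_psi p).comp _ Fin.val_injective)
  -- The e_j are n independent vectors in a kernel of dimension n, so the projection is determined
  -- by its values on them.
  have htop : Submodule.span ℂ (Set.range e) = ⊤ :=
    hli.span_eq_top_of_card_eq_finrank' (by rw [Fintype.card_fin, h.finrank_ker_W p hindex])
  rw [LinearMap.range_eq_map, ← htop, Submodule.map_span, ← Set.range_comp]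
  congr 2
  funext j
  exact h.matchingProj_apply p hg ε j.2

end IsFactorization

lemma evenSystem_eq (gp : ℝ → ℂ) (σ ε : ℂ) (m : ℕ) :
    evenSystem p gp σ ε m = fun k : Fin m =>
      W p gp⁻¹ (psi p (m - k - 1)) - (ε * σ) • W p gp⁻¹ (psi p (m + k)) := by
  funext k
  rw [evenSystem, map_sub, map_smul]

lemma oddSystem_eq (gp : ℝ → ℂ) (σ ε : ℂ) (m : ℕ) :
    oddSystem p gp σ ε m = fun k : Fin (m + 1) =>
      W p gp⁻¹ (psi p (m + k)) - (ε * σ) • W p gp⁻¹ (psi p (m - k)) := by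
  funext k
  rw [oddSystem, map_sub, map_smul]

end Kernel

end WienerHopf

theorem theorem2p2 (p : ℝ≥0∞) [Fact (1 ≤ p)] (g gm gp : ℝ → ℂ) (n : ℕ)
    (hgG : g ∈ WienerHopf.G) (hg : ∀ t : ℝ, g t * g (-t) = 1)
    (hFredholm : (WienerHopf.W p g).IsFredholm)
    (hindex : (WienerHopf.W p g).toLinearMap.index = (n : ℤ)) (hn : 0 < n)
    (hfac : WienerHopf.IsFactorization g gm gp (-(n : ℤ))) :
    (WienerHopf.sigma g n = 1 ∨ WienerHopf.sigma g n = -1) ∧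
    (∀ t : ℝ, gm t = WienerHopf.sigma g n * (gp (-t))⁻¹) ∧
    ∀ ε : ℂ, ε = 1 ∨ ε = -1 →
      (∀ m : ℕ, n = 2 * m →
        LinearIndependent ℂ (WienerHopf.evenSystem p gp (WienerHopf.sigma g n) ε m) ∧
        Submodule.span ℂ (Set.range (WienerHopf.evenSystem p gp (WienerHopf.sigma g n) ε m)) =
          LinearMap.range (WienerHopf.matchingProj p g ε) ∧
        Module.finrank ℂ (LinearMap.range (WienerHopf.matchingProj p g ε)) = m) ∧
      (∀ m : ℕ, n = 2 * m + 1 →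
        (∀ k : Fin (m + 1), WienerHopf.oddSystem p gp (WienerHopf.sigma g n) ε m k = 0 ↔
          k = 0 ∧ ε * WienerHopf.sigma g n = 1) ∧
        LinearIndependent ℂ
          (fun k : {k : Fin (m + 1) //
              WienerHopf.oddSystem p gp (WienerHopf.sigma g n) ε m k ≠ 0} =>
            WienerHopf.oddSystem p gp (WienerHopf.sigma g n) ε m k) ∧
        Submodule.span ℂ (Set.range (WienerHopf.oddSystem p gp (WienerHopf.sigma g n) ε m)) =
          LinearMap.range (WienerHopf.matchingProj p g ε) ∧
        (Module.finrank ℂ (LinearMap.range (WienerHopf.matchingProj p g ε)) : ℂ) =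
          m + (1 - ε * WienerHopf.sigma g n) / 2) := by
  have hσ := mul_self_eq_one_iff.1 (WienerHopf.sigma_mul_self hg n)
  refine ⟨hσ, hfac.minus_eq hg, fun ε hε => ?_⟩
  -- The choice of sign and σ(g) enter the two systems only through the product τ = εσ(g).
  have hτ : ε * WienerHopf.sigma g n = 1 ∨ ε * WienerHopf.sigma g n = -1 := by
    rcases hε with rfl | rfl <;> rcases hσ with h | h <;> simp [h]
  have hli := hfac.linearIndependent_plus_inv_psi p
  have hrange := hfac.range_matchingProj p hg hFredholm hindex ε
  constructor
  · rintro m rfl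
    exact WienerHopf.even_system_basis hli hτ
      (congrFun (WienerHopf.evenSystem_eq p gp _ ε m)) hrange
  · rintro m rfl
    exact WienerHopf.odd_system_basis hli hτ
      (congrFun (WienerHopf.oddSystem_eq p gp _ ε m)) hrange
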